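/- All ideals of $C^*$-algebras are closed and two-sided. For a $C^*$-algebra $\mathcal A$, a nonzero projection $p\in\mathcal A$ is minimal if $p\mathcal Ap=\mathbb Cp$, and $\mathcal I^{At}(\mathcal A)$ denotes the (closed) $*$-subalgebra of $\mathcal A$ generated by the minimal projections; it is an ideal of $\mathcal A$. $\mathcal A$ is scattered if $\mathcal I^{At}(\mathcal B)\neq\{0\}$ for every nonzero $C^*$-subalgebra $\mathcal B\subseteq\mathcal A$. The Cantor–Bendixson sequence of a scattered $\mathcal A$ is the unique strictly increasing sequence of ideals $(\mathcal I_\alpha)_{\alpha\le ht(\mathcal A)}$, continuous at limit ordinals (each limit term is the norm closure of the union of the previous terms), with $\mathcal I_0=\{0\}$, $\mathcal I_{ht(\mathcal A)}=\mathcal A$ and $\mathcal I^{At}(\mathcal A/\mathcal I_\alpha)=\{[a]_{\mathcal I_\alpha}:a\in\mathcal I_{\alpha+1}\}$ for all $\alpha<ht(\mathcal A)$; the ordinal $ht(\mathcal A)$ is the Cantor–Bendixson height. $CCR(\mathcal A)$ is the ideal of all $a\in\mathcal A$ such that $\pi(a)$ is a compact operator for every irreducible representation $\pi$ of $\mathcal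 A$. **Proposition.** Let $\mathcal K(\ell_2)$ be the algebra of compact operators on $\ell_2$, let $\widetilde{\mathcal K(\ell_2)}$ be its unitization, and let $\omega+1$ be the one-point compactification of the countable infinite discrete space. Let $$\mathcal A=C(\omega+1,\widetilde{\mathcal K(\ell_2)})\cong C(\omega+1)\otimes\widetilde{\mathcal K(\ell_2)},$$ where $\otimes$ is the unique $C^*$-tensor product: with the maps $f\otimes b\mapsto f(\cdot)b$, $\mathcal A$ is a $C^*$-completion of the algebraic tensor product, and every other $C^*$-completion of it is $*$-isomorphic to $\mathcal A$ by an isomorphism compatible with the embeddings of the two factors. Then $\mathcal A$ is scattered, it has a Cantor–Bendixson sequence $(\mathcal I_\alpha)_{\alpha\le ht(\mathcal A)}$, its height is $ht(\mathcal A)=3$, and $CCR(\mathcal A)\neq\mathcal I_\alpha$ for every $\alpha\le ht(\mathcal A)$. In particular, there are scattered $C^*$-algebras $\mathcal A$ such that the ideal $CCR(\mathcal A)$ does not appear in the Cantor–Bendixson sequence of $\mathcal A$. -/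

import Mathlib

noncomputable section

/-! ### Minimal projections and scattered C*-algebras -/

section Atoms

variable {A : Type*} [NonUnitalRing A] [StarRing A] [Module ℂ A]

/-- A minimal projection: a nonzero projection `p` with `p A p = ℂ p`. -/
def IsMinimalProjection (p : A) : Prop :=
  p ≠ 0 ∧ IsStarProjection p ∧
    Set.range (fun a : A => p * a * p) = Set.range (fun c : ℂ => c • p)

/-- `I^At(A)`: the closed *-subalgebra generated by the minimal projections (as a subset of `A`).
For a C*-algebra it is a closed two-sided ideal. -/
def atomIdeal (A : Type*) [NonUnitalRing A] [StarRing A] [Module ℂ A] [IsScalarTower ℂ A A]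
    [SMulCommClass ℂ A A] [StarModule ℂ A] [TopologicalSpace A] : Set A :=
  closure (NonUnitalStarAlgebra.adjoin ℂ {p : A | IsMinimalProjection p} : Set A)

end Atoms

/-- A C*-algebra is scattered if `I^At(B) ≠ {0}` for each nonzero C*-subalgebra `B`. -/
def IsScattered (A : Type*) [NonUnitalCStarAlgebra A] : Prop :=
  ∀ B : NonUnitalStarSubalgebra ℂ A, IsClosed (B : Set A) → (∃ b ∈ B, b ≠ 0) →
    atomIdeal B ≠ {0}

/-! ### Closed ideals and their quotients -/

/-- A closed two-sided ideal of a C*-algebra. In a C*-algebra every norm-closed two-sided ideal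
(in the sense of rings) is a linear subspace and is closed under `*`. -/
structure ClosedIdeal (A : Type*) [NonUnitalCStarAlgebra A] extends Submodule ℂ A where
  mul_mem_left' : ∀ (a : A) {x : A}, x ∈ carrier → a * x ∈ carrier
  mul_mem_right' : ∀ (a : A) {x : A}, x ∈ carrier → x * a ∈ carrier
  star_mem' : ∀ {x : A}, x ∈ carrier → star x ∈ carrier
  isClosed' : IsClosed carrier

namespace ClosedIdeal

variable {A : Type*} [NonUnitalCStarAlgebra A]

instance : SetLike (ClosedIdeal A) A where
  coe I := I.carrier
  coe_injective I J h := by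
    cases I; cases J; congr; exact SetLike.coe_injective h

instance : PartialOrder (ClosedIdeal A) := PartialOrder.ofSetLike (ClosedIdeal A) A

/-- The zero ideal. -/
instance : Bot (ClosedIdeal A) where
  bot :=
    { (⊥ : Submodule ℂ A) with
      mul_mem_left' := by
        intro a x (hx : x = 0)
        change a * x = 0
        rw [hx, mul_zero]
      mul_mem_right' := by
        intro a x (hx : x = 0)
        change x * a = 0
        rw [hx, zero_mul]
      star_mem' := by
        intro x (hx : x = 0)
        change star x = 0
        rw [hx, star_zero]
      isClosed' := isClosed_singleton }

/-- The whole algebra. -/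
instance : Top (ClosedIdeal A) where
  top :=
    { (⊤ : Submodule ℂ A) with
      mul_mem_left' := fun _ _ _ => trivial
      mul_mem_right' := fun _ _ _ => trivial
      star_mem' := fun _ => trivial
      isClosed' := isClosed_univ }

theorem mul_sub_mul_mem (I : ClosedIdeal A) {a a' b b' : A} (ha : a - a' ∈ I.toSubmodule)
    (hb : b - b' ∈ I.toSubmodule) : a * b - a' * b' ∈ I.toSubmodule := by
  have h : a * b - a' * b' = (a - a') * b + a' * (b - b') := by
    rw [sub_mul, mul_sub]; abel
  rw [h]
  exact I.toSubmodule.add_mem (I.mul_mem_right' b ha) (I.mul_mem_left' a' hb)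

/-- The quotient `A / I`, with the quotient operations and the quotient topology (the topology of
the quotient norm). -/
def Quot (I : ClosedIdeal A) : Type _ := A ⧸ I.toSubmodule

namespace Quot

variable (I : ClosedIdeal A)

instance : AddCommGroup I.Quot := inferInstanceAs (AddCommGroup (A ⧸ I.toSubmodule))
instance : Module ℂ I.Quot := inferInstanceAs (Module ℂ (A ⧸ I.toSubmodule))
instance : TopologicalSpace I.Quot := inferInstanceAs (TopologicalSpace (A ⧸ I.toSubmodule))

/-- The class `[a]` of `a` in `A / I`. -/
def mk (a : A) : I.Quot := Submodule.Quotient.mk (p := I.toSubmodule) a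

theorem mk_surjective : Function.Surjective (mk I) :=
  Submodule.Quotient.mk_surjective I.toSubmodule

instance : Mul I.Quot where
  mul := Quotient.map₂ (· * ·) (by
    intro a a' ha b b' hb
    exact (Submodule.quotientRel_def _).2 (I.mul_sub_mul_mem
      ((Submodule.quotientRel_def _).1 ha) ((Submodule.quotientRel_def _).1 hb)))

instance : Star I.Quot where
  star := Quotient.map star (by
    intro a a' ha
    refine (Submodule.quotientRel_def _).2 ?_
    rw [← star_sub]
    exact I.star_mem' ((Submodule.quotientRel_def _).1 ha))

@[simp] theorem mk_zero : mk I 0 = 0 := rfl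
@[simp] theorem mk_add (a b : A) : mk I (a + b) = mk I a + mk I b := rfl
@[simp] theorem mk_smul (c : ℂ) (a : A) : mk I (c • a) = c • mk I a := rfl
@[simp] theorem mk_mul (a b : A) : mk I (a * b) = mk I a * mk I b := rfl
@[simp] theorem mk_star (a : A) : mk I (star a) = star (mk I a) := rfl

theorem mk_eq_mk_iff (a b : A) : mk I a = mk I b ↔ a - b ∈ I :=
  Submodule.Quotient.eq I.toSubmodule

instance : NonUnitalRing I.Quot where
  left_distrib := by
    rintro ⟨a⟩ ⟨b⟩ ⟨c⟩
    exact congrArg (mk I) (mul_add a b c)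
  right_distrib := by
    rintro ⟨a⟩ ⟨b⟩ ⟨c⟩
    exact congrArg (mk I) (add_mul a b c)
  zero_mul := by
    rintro ⟨a⟩
    exact congrArg (mk I) (zero_mul a)
  mul_zero := by
    rintro ⟨a⟩
    exact congrArg (mk I) (mul_zero a)
  mul_assoc := by
    rintro ⟨a⟩ ⟨b⟩ ⟨c⟩
    exact congrArg (mk I) (mul_assoc a b c)

instance : StarRing I.Quot where
  star_involutive := by
    rintro ⟨a⟩
    exact congrArg (mk I) (star_star a)
  star_mul := by
    rintro ⟨a⟩ ⟨b⟩
    exact congrArg (mk I) (star_mul a b)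
  star_add := by
    rintro ⟨a⟩ ⟨b⟩
    exact congrArg (mk I) (star_add a b)

instance : StarModule ℂ I.Quot where
  star_smul := by
    rintro c ⟨a⟩
    exact congrArg (mk I) (star_smul c a)

instance : IsScalarTower ℂ I.Quot I.Quot where
  smul_assoc := by
    rintro c ⟨a⟩ ⟨b⟩
    exact congrArg (mk I) (smul_mul_assoc c a b)

instance : SMulCommClass ℂ I.Quot I.Quot where
  smul_comm := by
    rintro c ⟨a⟩ ⟨b⟩
    exact congrArg (mk I) (mul_smul_comm c a b).symm

end Quot

end ClosedIdeal

/-! ### The Cantor–Bendixson sequence -/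

universe u

/-- `(I_α)_{α ≤ θ}` is the Cantor–Bendixson sequence of `A`, and `θ` is the Cantor–Bendixson height:
a continuous strictly increasing sequence of closed ideals with `I_0 = 0`, `I_θ = A` and
`I^At(A / I_α) = {[a] : a ∈ I_{α+1}}` for `α < θ`. (Values of `I` beyond `θ` are irrelevant.) -/
structure IsCantorBendixsonSequence (A : Type u) [NonUnitalCStarAlgebra A] (θ : Ordinal.{u})
    (I : Ordinal.{u} → ClosedIdeal A) : Prop where
  zero : I 0 = ⊥
  top : I θ = ⊤
  strictMono : ∀ α β, α < β → β ≤ θ → I α < I β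
  continuous : ∀ α ≤ θ, Order.IsSuccLimit α →
    (I α : Set A) = closure (⋃ β < α, (I β : Set A))
  derivative : ∀ α < θ,
    atomIdeal (I α).Quot = ClosedIdeal.Quot.mk (I α) '' (I (Order.succ α) : Set A)

/-! ### Compact operators -/

section Compact

variable {H : Type*} [NormedAddCommGroup H] [InnerProductSpace ℂ H] [CompleteSpace H]

theorem isCompactOperator_star {T : H →L[ℂ] H} (hT : IsCompactOperator T) :
    IsCompactOperator (star T : H →L[ℂ] H) := by
  have hS : IsCompactOperator (T * star T) := hT.comp_clm (star T)
  have hK := hS.isCompact_closure_image_ball (f := ((T * star T : H →L[ℂ] H) : H →ₗ[ℂ] H)) 1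
  have hTB : TotallyBounded ((T * star T : H →L[ℂ] H) '' Metric.ball 0 1) :=
    hK.totallyBounded.subset subset_closure
  refine (isCompactOperator_iff_isCompact_closure_image_ball
    ((star T : H →L[ℂ] H) : H →ₗ[ℂ] H) one_pos).2 ?_
  refine TotallyBounded.isCompact_of_isClosed ?_ isClosed_closure
  refine TotallyBounded.closure ?_
  refine Metric.totallyBounded_iff.2 fun ε hε => ?_
  obtain ⟨s, hs, hsf, hcov⟩ := Set.exists_subset_image_finite_and.1
    (Metric.finite_approx_of_totallyBounded hTB (ε ^ 2 / 2) (by positivity))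
  refine ⟨(star T : H →L[ℂ] H) '' s, hsf.image _, ?_⟩
  rintro _ ⟨x, hx, rfl⟩
  have h1 := hcov (Set.mem_image_of_mem _ hx)
  simp only [Set.mem_iUnion, Set.mem_image, exists_prop] at h1
  obtain ⟨_, ⟨y, hy, rfl⟩, hxy⟩ := h1
  simp only [Set.mem_iUnion, Set.mem_image, exists_prop]
  refine ⟨_, ⟨y, hy, rfl⟩, ?_⟩
  rw [Metric.mem_ball, dist_eq_norm] at hxy ⊢
  change ‖star T x - star T y‖ < ε
  rw [← map_sub] at hxy ⊢
  have hyb := hs hy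
  rw [mem_ball_zero_iff] at hyb hx
  have h2 : ‖x - y‖ ≤ 2 := (norm_sub_le _ _).trans (by linarith)
  have h3 : ‖star T (x - y)‖ ^ 2 ≤ ‖(T * star T) (x - y)‖ * ‖x - y‖ := by
    rw [← inner_self_eq_norm_sq (𝕜 := ℂ), ContinuousLinearMap.star_eq_adjoint,
      ContinuousLinearMap.adjoint_inner_right]
    exact (RCLike.re_le_norm _).trans (norm_inner_le_norm _ _)
  have h4 : ‖star T (x - y)‖ ^ 2 < ε ^ 2 := by
    nlinarith [norm_nonneg (x - y), norm_nonneg ((T * star T) (x - y))]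
  exact lt_of_pow_lt_pow_left₀ 2 hε.le h4

variable (H) in
/-- The C*-algebra `K(H)` of compact operators on a complex Hilbert space `H`. -/
def compactOperators : NonUnitalStarSubalgebra ℂ (H →L[ℂ] H) where
  carrier := {T | IsCompactOperator T}
  zero_mem' := isCompactOperator_zero
  add_mem' := fun ha hb => ha.add hb
  mul_mem' := fun {_ b} ha _ => ha.comp_clm b
  smul_mem' := fun c _ ha => ha.smul c
  star_mem' := fun ha => isCompactOperator_star ha

instance compactOperators_isClosed : IsClosed (compactOperators H : Set (H →L[ℂ] H)) :=
  isClosed_setOfPred_isCompactOperator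

end Compact

/-! ### Irreducible representations and the ideal `CCR(A)` -/

/-- A nonzero representation of a C*-algebra on a Hilbert space is irreducible if it has no
nontrivial closed invariant subspace. -/
def IsIrreducibleRep {A : Type*} [NonUnitalCStarAlgebra A] {H : Type*} [NormedAddCommGroup H]
    [InnerProductSpace ℂ H] [CompleteSpace H] (π : A →⋆ₙₐ[ℂ] (H →L[ℂ] H)) : Prop :=
  π ≠ 0 ∧ ∀ S : Submodule ℂ H, IsClosed (S : Set H) → (∀ a, ∀ x ∈ S, π a x ∈ S) → S = ⊥ ∨ S = ⊤

/-- `CCR(A)`: the ideal of all elements which are sent to a compact operator by each irreducible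
representation. (An irreducible representation is cyclic, so up to unitary equivalence its Hilbert
space lives in the universe of `A`.) -/
def ccrIdeal (A : Type u) [NonUnitalCStarAlgebra A] : ClosedIdeal A where
  carrier := {a | ∀ (H : Type u) [NormedAddCommGroup H] [InnerProductSpace ℂ H] [CompleteSpace H]
    (π : A →⋆ₙₐ[ℂ] (H →L[ℂ] H)), IsIrreducibleRep π → IsCompactOperator (π a)}
  zero_mem' := by
    intro H _ _ _ π _
    rw [map_zero]
    exact (compactOperators H).zero_mem
  add_mem' := by
    intro a b ha hb H _ _ _ π h
    rw [map_add]
    exact (compactOperators H).add_mem (ha H π h) (hb H π h)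
  smul_mem' := by
    intro c a ha H _ _ _ π h
    rw [map_smul]
    exact (compactOperators H).smul_mem c (ha H π h)
  mul_mem_left' := by
    intro a x hx H _ _ _ π h
    rw [map_mul]
    exact (hx H π h).clm_comp (π a)
  mul_mem_right' := by
    intro a x hx H _ _ _ π h
    rw [map_mul]
    exact (hx H π h).comp_clm (π a)
  star_mem' := by
    intro x hx H _ _ _ π h
    rw [map_star]
    exact isCompactOperator_star (hx H π h)
  isClosed' := by
    simp only [Set.ofPred_forall]
    refine isClosed_iInter fun H => isClosed_iInter fun _ => isClosed_iInter fun _ =>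
      isClosed_iInter fun _ => isClosed_iInter fun π => isClosed_iInter fun _ => ?_
    have hc : Continuous π :=
      AddMonoidHomClass.continuous_of_bound π 1 fun a => by
        rw [one_mul]; exact NonUnitalStarAlgHom.norm_apply_le π a
    exact (compactOperators_isClosed (H := H)).preimage hc

/-! ### C*-tensor products -/

/-- `T`, with the unital *-homomorphisms `i : a ↦ a ⊗ 1` and `j : b ↦ 1 ⊗ b`, is a C*-tensor product
of the unital C*-algebras `A` and `B`, i.e. a completion of the algebraic tensor product `A ⊗ B` with
respect to some C*-norm: the images commute and the *-homomorphism `a ⊗ b ↦ i a * j b` on the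
algebraic tensor product is injective with dense range. -/
structure IsCStarTensorProduct {A B T : Type*} [CStarAlgebra A] [CStarAlgebra B] [CStarAlgebra T]
    (i : A →⋆ₐ[ℂ] T) (j : B →⋆ₐ[ℂ] T) : Prop where
  commute : ∀ a b, Commute (i a) (j b)
  injective : Function.Injective (Algebra.TensorProduct.lift (i : A →ₐ[ℂ] T) (j : B →ₐ[ℂ] T) commute)
  dense : DenseRange (Algebra.TensorProduct.lift (i : A →ₐ[ℂ] T) (j : B →ₐ[ℂ] T) commute)

/-! ### The algebra -/

/-- The Hilbert space `ℓ₂`. -/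
abbrev EllTwo : Type := lp (fun _ : ℕ => ℂ) 2

/-- The unitization of `K(ℓ₂)`, with its C*-norm. -/
abbrev UnitizedCompacts : Type := Unitization ℂ (compactOperators EllTwo)

/-- `ω + 1`, the one-point compactification of the countable infinite discrete space. -/
abbrev OmegaPlusOne : Type := OnePoint ℕ

/-- The C*-algebra `C(ω + 1, K(ℓ₂)~)` of continuous functions, with pointwise operations and the
supremum norm. -/
abbrev ExampleAlgebra : Type := C(OmegaPlusOne, UnitizedCompacts)

end

/-! Write `Y` for the unitization of `K = K(ℓ₂)` and `σ : Y → ℂ` for the character with kernel `K`.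
The Cantor–Bendixson sequence of `C(ω + 1, Y)` is `0 < I₁ < I₂ < A`, where `I₁` consists of the `f`
with `f n ∈ K` and `f ∞ = 0`, and `I₂` of the `f` with `f ∞ ∈ K`. The constant function at a rank
one projection lies in `CCR(A)` but not in `I₁`, and the point mass `δ₀ 1` lies in `I₂` but not in
`CCR(A)`. Hence `CCR(A)` is none of the four ideals (`exampleSequence_ne_ccrIdeal`).

Derivatives: minimal projections modulo `I` outside an ideal `J ⊇ I` annihilate `J` modulo `I`. As
`K` is essential in `Y`, and as values at `∞` are limits, none is left outside the next ideal.
Conversely, point masses and constants at minimal projections, `δₙ 1` and finally `1` span the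
successive quotients, because truncations converge uniformly. A sequence with a finite height is
determined by its derivatives (`height_eq`, `natCast_eq`).

Scatteredness: a closed subalgebra `B` inherits a minimal projection from `B ∩ ker φ`, or from
`φ(B)` when `φ` is injective on `B` (`HasAtom.of_hom`). Evaluations, shifts, `σ` and the
representation on `ℓ₂` reduce the claim to subalgebras of `ℂ` and of `K`; in the latter a projection
of least rank is minimal.

Tensor product: truncation takes values in the algebraic tensor product and is a `*`-homomorphism,
so it is contractive for every C*-norm. The limit of truncations identifies any completion with `C(ω
+ 1, Y)`. -/

noncomputable section

open Filter Topology InnerProductSpace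

universe u

/-! ### Spectral projections of compact self-adjoint operators -/

section CompactOperators

variable {H : Type*} [NormedAddCommGroup H] [InnerProductSpace ℂ H] [CompleteSpace H]

/-- For a self-adjoint operator the spectral radius is the norm, and a nonzero spectral value of a
compact operator is an eigenvalue. -/
theorem exists_eigenvector_norm_eq {T : H →L[ℂ] H} (hT : IsCompactOperator T)
    (hsa : IsSelfAdjoint T) (h0 : T ≠ 0) :
    ∃ (r : ℝ) (v : H), |r| = ‖T‖ ∧ v ≠ 0 ∧ T v = (r : ℂ) • v := by
  have : Nontrivial H := by
    by_contra h
    rw [not_nontrivial_iff_subsingleton] at h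
    exact h0 (Subsingleton.elim _ _)
  obtain ⟨μ, hμ, hn⟩ := spectrum.exists_nnnorm_eq_spectralRadius T
  rw [T.spectralRadius_eq_nnnorm hsa, ENNReal.coe_inj] at hn
  have hn' : ‖μ‖ = ‖T‖ := congrArg NNReal.toReal hn
  have hμ0 : μ ≠ 0 := by
    rintro rfl
    rw [norm_zero] at hn'
    exact h0 (norm_eq_zero.1 hn'.symm)
  have he := (hT.hasEigenvalue_iff_mem_spectrum hμ0).2 hμ
  have hre : (starRingEnd ℂ) μ = μ := hsa.isSymmetric.conj_eigenvalue_eq_self he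
  obtain ⟨v, hv⟩ := he.exists_hasEigenvector
  have hμr : ((μ.re : ℝ) : ℂ) = μ := Complex.conj_eq_iff_re.1 hre
  refine ⟨μ.re, v, ?_, hv.2, ?_⟩
  · rw [← hn', ← hμr, Complex.norm_real]; simp
  · rw [hμr]
    exact Module.End.mem_eigenspace_iff.1 hv.1

theorem add_pow_of_mul_eq_zero {R : Type*} [Ring R] {q s : R} (hq : q * q = q) (hqs : q * s = 0)
    (hsq : s * q = 0) (n : ℕ) : (q + s) ^ (n + 1) = q + s ^ (n + 1) := by
  induction n with
  | zero => simp
  | succ n ih =>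
    have : s ^ (n + 1) * q = 0 := by rw [pow_succ, mul_assoc, hsq, mul_zero]
    rw [pow_succ, ih, add_mul, mul_add, mul_add, hq, hqs, this, ← pow_succ]
    simp

/-- A closed `*`-algebra of operators contains the spectral projection of a nonzero compact
self-adjoint element `y`, for the eigenvalue `‖y‖²` of `y²`. -/
theorem exists_spectral_projection_mem {B : NonUnitalStarSubalgebra ℂ (H →L[ℂ] H)}
    (hB : IsClosed (B : Set (H →L[ℂ] H))) {y : H →L[ℂ] H} (hyB : y ∈ B)
    (hy : IsCompactOperator y) (hsa : IsSelfAdjoint y) (h0 : y ≠ 0) :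
    ∃ q ∈ B, q ≠ 0 ∧ IsStarProjection q ∧
      ∃ c : ℝ, c ≠ 0 ∧ y * y * q = (c : ℂ) • q ∧ q * (y * y) = (c : ℂ) • q := by
  obtain ⟨r, v, hr, hv0, hv⟩ := exists_eigenvector_norm_eq hy hsa h0
  have hypos : 0 < ‖y‖ := norm_pos_iff.2 h0
  set d : ℝ := ‖y‖ ^ 2 with hd
  have hdpos : 0 < d := by positivity
  have hdr : d = r ^ 2 := by rw [hd, ← hr, sq_abs]
  have hdC : (d : ℂ) ≠ 0 := by exact_mod_cast hdpos.ne'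
  -- Squaring `y` merges the eigenvalues `±‖y‖`, so that after normalization `1` is the only
  -- eigenvalue of `T` of modulus one.
  set T : H →L[ℂ] H := ((d⁻¹ : ℝ) : ℂ) • (y * y) with hT
  have hyT : y * y = (d : ℂ) • T := by
    rw [hT, smul_smul, Complex.ofReal_inv, mul_inv_cancel₀ hdC, one_smul]
  have hTB : T ∈ B := B.smul_mem _ (B.mul_mem hyB hyB)
  have hTsa : IsSelfAdjoint T := by
    rw [hT, IsSelfAdjoint, star_smul, star_mul, hsa.star_eq]
    simp
  have hTn : ‖T‖ ≤ 1 := by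
    rw [hT, norm_smul, Complex.norm_real, Real.norm_of_nonneg (by positivity)]
    calc d⁻¹ * ‖y * y‖ ≤ d⁻¹ * (‖y‖ * ‖y‖) := by gcongr; exact norm_mul_le _ _
      _ = 1 := by rw [← sq, ← hd, inv_mul_cancel₀ hdpos.ne']
  have hTc : IsCompactOperator T :=
    by
    have hyK : y ∈ compactOperators H := hy
    exact (SMulMemClass.smul_mem _ (mul_mem hyK hyK) : T ∈ compactOperators H)
  let E : Submodule ℂ H := LinearMap.ker ((T - 1 : H →L[ℂ] H) : H →ₗ[ℂ] H)
  have hE : ∀ x, x ∈ E ↔ T x = x := fun x => by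
    simp [E, LinearMap.mem_ker, sub_eq_zero]
  have hEc : IsClosed (E : Set H) := ContinuousLinearMap.isClosed_ker (T - 1)
  have : CompleteSpace E := hEc.completeSpace_coe
  let q : H →L[ℂ] H := E.starProjection
  have hq : IsStarProjection q := isStarProjection_starProjection
  have hqq : q * q = q := hq.isIdempotentElem
  have hqE : ∀ x, q x ∈ E := fun x => E.starProjection_apply_mem x
  have hqx : ∀ x ∈ E, q x = x := fun x hx => Submodule.starProjection_eq_self_iff.2 hx
  have hTq : T * q = q := by
    ext1 x
    exact (hE _).1 (hqE x)
  have hqT : q * T = q := by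
    have := congrArg star hTq
    rwa [star_mul, hTsa.star_eq, hq.isSelfAdjoint.star_eq] at this
  set S := T - q with hS
  have hqS : q * S = 0 := by rw [hS, mul_sub, hqT, hqq, sub_self]
  have hSq : S * q = 0 := by rw [hS, sub_mul, hTq, hqq, sub_self]
  have hST : S = T * (1 - q) := by rw [mul_sub, hTq, mul_one]
  have hSsa : IsSelfAdjoint S := hTsa.sub hq.isSelfAdjoint
  have hSc : IsCompactOperator S := by
    rw [hST]; exact hTc.comp_clm (1 - q)
  -- Positivity of `T`: if `T x = -x`, then `‖y x‖² = ⟪x, y² x⟫ = -d ‖x‖²`.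
  have hpos : ∀ x, T x = -x → x = 0 := by
    intro x hx
    have h1 : y (y x) = -((d : ℂ) • x) := by
      have := congrArg (fun R : H →L[ℂ] H => R x) hyT
      simpa [hx] using this
    have h2 : inner ℂ (y x) (y x) = -(d : ℂ) * inner ℂ x x := by
      have := hsa.isSymmetric x (y x)
      simp only [ContinuousLinearMap.coe_coe] at this
      rw [this, h1, inner_neg_right, inner_smul_right]; ring
    rw [inner_self_eq_norm_sq_to_K, inner_self_eq_norm_sq_to_K] at h2
    simp only [Complex.coe_algebraMap, ← Complex.ofReal_pow, ← Complex.ofReal_neg,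
      ← Complex.ofReal_mul] at h2
    have h3 : ‖y x‖ ^ 2 = -d * ‖x‖ ^ 2 := Complex.ofReal_injective h2
    have : ‖x‖ ^ 2 = 0 := by nlinarith [sq_nonneg ‖y x‖, sq_nonneg ‖x‖]
    simpa using this
  -- Otherwise the compact operator `S` has an eigenvector for `1` or `-1`. It is orthogonal to the
  -- range of `q`, hence an eigenvector of `T`: the value `1` puts it into `E`, and `-1` is excluded
  -- by `hpos`.
  have hS1 : ‖S‖ < 1 := by
    have hle : ‖S‖ ≤ 1 := by
      rw [hST]
      have h1q : ‖(1 : H →L[ℂ] H) - q‖ ≤ 1 := hq.one_sub.norm_le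
      calc ‖T * (1 - q)‖ ≤ ‖T‖ * ‖1 - q‖ := norm_mul_le _ _
        _ ≤ 1 * 1 := by gcongr
        _ = 1 := one_mul 1
    refine lt_of_le_of_ne hle fun h1 => ?_
    have hS0 : S ≠ 0 := by
      intro h; rw [h, norm_zero] at h1; exact zero_ne_one h1
    obtain ⟨s, w, hs, hw0, hw⟩ := exists_eigenvector_norm_eq hSc hSsa hS0
    rw [h1] at hs
    have hs0 : (s : ℂ) ≠ 0 := by
      intro h
      rw [Complex.ofReal_eq_zero.1 h, abs_zero] at hs
      exact zero_ne_one hs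
    have hqw : q w = 0 := by
      have h2 : q (S w) = 0 := by
        change (q * S) w = 0
        rw [hqS]; rfl
      rw [hw, map_smul] at h2
      exact (smul_eq_zero.1 h2).resolve_left hs0
    have hTw : T w = (s : ℂ) • w := by
      have : S w = T w - q w := rfl
      rw [← hw, this, hqw, sub_zero]
    rcases abs_eq (zero_le_one) |>.1 hs with rfl | rfl
    · have : w ∈ E := (hE w).2 (by simpa using hTw)
      exact hw0 ((hqx w this).symm.trans hqw)
    · exact hw0 (hpos w (by simpa using hTw))
  -- The powers of `T = q + S` are `q + Sⁿ⁺¹`, which puts `q` into the closed algebra `B` without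
  -- functional calculus.
  have hlim : Tendsto (fun n : ℕ => T ^ (n + 1)) atTop (𝓝 q) := by
    have h1 : (fun n : ℕ => T ^ (n + 1)) = fun n : ℕ => q + S ^ (n + 1) := by
      funext n
      rw [← add_pow_of_mul_eq_zero hqq hqS hSq, hS, add_sub_cancel]
    rw [h1]
    have := (tendsto_pow_atTop_nhds_zero_of_norm_lt_one hS1).comp (tendsto_add_atTop_nat 1)
    simpa using this.const_add q
  have hqB : q ∈ B := by
    refine hB.mem_of_tendsto hlim (Eventually.of_forall fun n => ?_)
    induction n with
    | zero => simpa using hTB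
    | succ n ih => rw [pow_succ]; exact B.mul_mem ih hTB
  refine ⟨q, hqB, ?_, hq, d, hdpos.ne', ?_, ?_⟩
  · intro h
    have hvE : v ∈ E := by
      rw [hE]
      have : T v = ((d⁻¹ : ℝ) : ℂ) • y (y v) := rfl
      rw [this, hv, map_smul, hv, smul_smul, smul_smul, mul_assoc]
      have : ((d⁻¹ : ℝ) : ℂ) * (r * r) = 1 := by
        rw [← sq, ← Complex.ofReal_pow, ← hdr, Complex.ofReal_inv, inv_mul_cancel₀ hdC]
      rw [this, one_smul]
    have := hqx v hvE
    rw [h] at this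
    exact hv0 this.symm
  · rw [hyT, smul_mul_assoc, hTq]
  · rw [hyT, mul_smul_comm, hqT]

theorem finiteDimensional_range_of_isCompactOperator {p : H →L[ℂ] H} (hp : IsCompactOperator p)
    (hpp : p * p = p) : FiniteDimensional ℂ (LinearMap.range (p : H →ₗ[ℂ] H)) := by
  have := ContinuousLinearMap.finite_dimensional_eigenspace hp 1 one_ne_zero
  have hle : LinearMap.range (p : H →ₗ[ℂ] H) ≤ Module.End.eigenspace (p : H →ₗ[ℂ] H) 1 := by
    rintro _ ⟨x, rfl⟩
    rw [Module.End.mem_eigenspace_iff, one_smul]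
    exact congrArg (fun R : H →L[ℂ] H => R x) hpp
  exact Submodule.finiteDimensional_of_le hle

end CompactOperators

/-- A `*`-subalgebra has an atom if it contains a minimal projection (of the subalgebra). -/
def HasAtom {A : Type*} [NonUnitalCStarAlgebra A] (B : NonUnitalStarSubalgebra ℂ A) : Prop :=
  ∃ p ∈ B, p ≠ 0 ∧ IsStarProjection p ∧ ∀ b ∈ B, ∃ c : ℂ, p * b * p = c • p

/-- The corner condition is linear in `b`, so the real and imaginary parts suffice; the spectral
theorem applies to these. -/
theorem exists_scalar_of_isSelfAdjoint {A : Type*} [NonUnitalCStarAlgebra A]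
    {B : NonUnitalStarSubalgebra ℂ A} {p : A}
    (h : ∀ b ∈ B, IsSelfAdjoint b → ∃ c : ℂ, p * b * p = c • p) :
    ∀ b ∈ B, ∃ c : ℂ, p * b * p = c • p := by
  intro b hb
  have hbs : star b ∈ B := star_mem hb
  have hre : ((realPart b : selfAdjoint A) : A) ∈ B := by
    rw [realPart_apply_coe]
    exact (B.toSubmodule.restrictScalars ℝ).smul_mem _ (B.add_mem hb hbs)
  have him : ((imaginaryPart b : selfAdjoint A) : A) ∈ B := by
    rw [imaginaryPart_apply_coe]
    exact B.smul_mem _ ((B.toSubmodule.restrictScalars ℝ).smul_mem _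
      (sub_mem hb hbs))
  obtain ⟨c, hc⟩ := h _ hre (realPart b).2
  obtain ⟨d, hd⟩ := h _ him (imaginaryPart b).2
  refine ⟨c + Complex.I * d, ?_⟩
  conv_lhs => rw [← realPart_add_I_smul_imaginaryPart b]
  rw [mul_add, add_mul, hc, mul_smul_comm, smul_mul_assoc, hd, smul_smul, add_smul]

/-- Projections in `B` have finite rank; take `p` of least positive rank. A non-scalar self-adjoint
element of `p B p` would have a spectral projection strictly below `p`. -/
theorem HasAtom.of_le_compactOperators {H : Type*} [NormedAddCommGroup H] [InnerProductSpace ℂ H]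
    [CompleteSpace H] {B : NonUnitalStarSubalgebra ℂ (H →L[ℂ] H)}
    (hB : IsClosed (B : Set (H →L[ℂ] H))) (hK : B ≤ compactOperators H)
    (hne : ∃ b ∈ B, b ≠ 0) : HasAtom B := by
  let P : Set (H →L[ℂ] H) := {p | p ∈ B ∧ p ≠ 0 ∧ IsStarProjection p}
  have hP : P.Nonempty := by
    obtain ⟨b, hb, hb0⟩ := hne
    have hbb : star b * b ∈ B := mul_mem (star_mem hb) hb
    obtain ⟨q, hqB, hq0, hq, -⟩ := exists_spectral_projection_mem hB hbb (hK hbb)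
      (IsSelfAdjoint.star_mul_self b) (fun h => hb0 (CStarRing.star_mul_self_eq_zero_iff b |>.1 h))
    exact ⟨q, hqB, hq0, hq⟩
  let d : (H →L[ℂ] H) → ℕ := fun p => Module.finrank ℂ (LinearMap.range (p : H →ₗ[ℂ] H))
  obtain ⟨p, ⟨hpB, hp0, hp⟩, hmin⟩ := WellFounded.has_min (InvImage.wf d Nat.lt_wfRel.wf) P hP
  have hpp : p * p = p := hp.isIdempotentElem
  have hps : star p = p := hp.isSelfAdjoint.star_eq
  refine ⟨p, hpB, hp0, hp, exists_scalar_of_isSelfAdjoint fun x hx hxs => ?_⟩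
  set z := p * x * p with hz
  have hzB : z ∈ B := B.mul_mem (B.mul_mem hpB hx) hpB
  have hzs : IsSelfAdjoint z := by
    rw [IsSelfAdjoint, hz, star_mul, star_mul, hps, hxs.star_eq, mul_assoc]
  have hpz : p * z = z := by rw [hz, ← mul_assoc, ← mul_assoc, hpp]
  by_cases hz0 : z = 0
  · exact ⟨0, by rw [hz0, zero_smul]⟩
  obtain ⟨r, v, hr, hv0, hv⟩ := exists_eigenvector_norm_eq (hK hzB) hzs hz0
  have hr0 : (r : ℂ) ≠ 0 := by
    intro h
    rw [Complex.ofReal_eq_zero.1 h, abs_zero] at hr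
    exact hz0 (norm_eq_zero.1 hr.symm)
  have hpv : p v = v := by
    have h1 : p (z v) = z v := congrArg (fun R : H →L[ℂ] H => R v) hpz
    rw [hv, map_smul] at h1
    exact smul_right_injective H hr0 h1
  refine ⟨r, ?_⟩
  by_contra hne
  -- Subtracting the eigenvalue makes `y` kill `v`, a vector in the range of `p`. The spectral
  -- projection `q` of `y²` then lies under `p` and misses `v`, so its rank is smaller.
  set y := z - (r : ℂ) • p with hy
  have hyB : y ∈ B := sub_mem hzB (B.smul_mem _ hpB)
  have hys : IsSelfAdjoint y := by
    refine hzs.sub ?_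
    rw [IsSelfAdjoint, star_smul, hps]; simp
  have hyv : y v = 0 := by
    change z v - (r : ℂ) • p v = 0
    rw [hv, hpv, sub_self]
  have hpy : p * y = y := by rw [hy, mul_sub, hpz, mul_smul_comm, hpp]
  obtain ⟨q, hqB, hq0, hq, c, hc0, hyq, hqy⟩ :=
    exists_spectral_projection_mem hB hyB (hK hyB) hys (sub_ne_zero.2 hne)
  have hcC : (c : ℂ) ≠ 0 := by exact_mod_cast hc0
  refine hmin q ⟨hqB, hq0, hq⟩ ?_
  have := finiteDimensional_range_of_isCompactOperator (hK hpB) hpp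
  refine Submodule.finrank_lt_finrank_of_lt (lt_of_le_of_ne ?_ ?_)
  · rintro _ ⟨x, rfl⟩
    have h1 : p * ((c : ℂ) • q) = (c : ℂ) • q := by
      rw [← hyq, ← mul_assoc, ← mul_assoc, hpy]
    rw [mul_smul_comm] at h1
    have h2 : p * q = q := smul_right_injective _ hcC h1
    exact ⟨q x, congrArg (fun R : H →L[ℂ] H => R x) h2⟩
  · intro heq
    have hvr : v ∈ LinearMap.range (q : H →ₗ[ℂ] H) := heq ▸ ⟨v, hpv⟩
    obtain ⟨w, hw⟩ := hvr
    have hqv : q v = v := by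
      rw [← hw]
      exact congrArg (fun R : H →L[ℂ] H => R w) hq.isIdempotentElem
    have h1 : q (y (y v)) = (c : ℂ) • q v := congrArg (fun R : H →L[ℂ] H => R v) hqy
    rw [hyv, map_zero, map_zero, hqv] at h1
    exact hv0 ((smul_eq_zero.1 h1.symm).resolve_left hcC)

/-! ### Approximation of compact operators by rank one operators -/

section RankOne

variable {H : Type*} [NormedAddCommGroup H] [InnerProductSpace ℂ H]

theorem isCompactOperator_rankOne (x y : H) : IsCompactOperator (rankOne ℂ x y) := by
  rw [rankOne_def']
  exact (isCompactOperator_of_locallyCompactSpace_rng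
    (ContinuousLinearMap.toSpanSingleton ℂ x)).comp_clm (innerSL ℂ y)

theorem exists_finiteDimensional_norm_sub_le {T : H →L[ℂ] H} (hT : IsCompactOperator T) {ε : ℝ}
    (hε : 0 < ε) : ∃ (E : Submodule ℂ H) (_ : FiniteDimensional ℂ E),
      ‖T - E.starProjection * T‖ ≤ ε := by
  have hK := hT.isCompact_closure_image_closedBall (f := (T : H →ₗ[ℂ] H)) 1
  have hTB : TotallyBounded (T '' Metric.closedBall 0 1) :=
    hK.totallyBounded.subset subset_closure
  obtain ⟨s, hs, hsf, hcov⟩ := Metric.finite_approx_of_totallyBounded hTB ε hε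
  have : FiniteDimensional ℂ (Submodule.span ℂ s) := FiniteDimensional.span_of_finite ℂ hsf
  refine ⟨Submodule.span ℂ s, this, ContinuousLinearMap.opNorm_le_of_unit_norm hε.le ?_⟩
  intro x hx
  have h1 := hcov (Set.mem_image_of_mem T (mem_closedBall_zero_iff.2 hx.le))
  simp only [Set.mem_iUnion, exists_prop] at h1
  obtain ⟨y, hy, hxy⟩ := h1
  rw [Metric.mem_ball, dist_eq_norm] at hxy
  have hyE : y ∈ Submodule.span ℂ s := Submodule.subset_span hy
  -- `E` is spanned by a finite `ε`-net of the image of the unit ball, and `1 - P_E` does not see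
  -- the net point `y`.
  have h2 : (T - (Submodule.span ℂ s).starProjection * T) x =
      (Submodule.span ℂ s)ᗮ.starProjection (T x - y) := by
    rw [Submodule.starProjection_orthogonal']
    simp [Submodule.starProjection_eq_self_iff.2 hyE]
  rw [h2]
  exact ((Submodule.starProjection_norm_le _).trans' (le_refl _) |> fun h =>
    (ContinuousLinearMap.le_of_opNorm_le _ h _)).trans (by rw [one_mul]; exact hxy.le)

variable [CompleteSpace H]

/-- The rank one operator `z ↦ ⟪y, z⟫ x` as an element of `K(H)`. -/
def rankOneCompact (x y : H) : compactOperators H := ⟨rankOne ℂ x y, isCompactOperator_rankOne x y⟩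

theorem rankOneCompact_mem {S : Submodule ℂ (compactOperators H)}
    (h : ∀ x : H, ‖x‖ = 1 → rankOneCompact x x ∈ S) (x y : H) : rankOneCompact x y ∈ S := by
  have h1 : ∀ x : H, rankOneCompact x x ∈ S := by
    intro x
    by_cases hx : x = 0
    · have : rankOneCompact x x = 0 := by
        apply Subtype.ext; simp [rankOneCompact, hx]
      rw [this]; exact S.zero_mem
    · have hx' : (‖x‖ : ℂ) ≠ 0 := by exact_mod_cast norm_ne_zero_iff.2 hx
      have : rankOneCompact x x =
          ((‖x‖ : ℂ) ^ 2) • rankOneCompact (((‖x‖⁻¹ : ℝ) : ℂ) • x) (((‖x‖⁻¹ : ℝ) : ℂ) • x) := by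
        apply Subtype.ext
        change rankOne ℂ x x = ((‖x‖ : ℂ) ^ 2) • rankOne ℂ _ _
        ext z
        simp only [rankOne_apply, smul_apply, inner_smul_left, smul_smul,
          Complex.conj_ofReal]
        congr 1
        push_cast
        field_simp
      rw [this]
      refine S.smul_mem _ (h _ ?_)
      rw [norm_smul, Complex.norm_real, norm_inv, norm_norm, inv_mul_cancel₀ (norm_ne_zero_iff.2 hx)]
  -- Polarization: the rank one operator is linear in `x` and conjugate linear in `y`.
  have h2 : rankOneCompact x y = (4⁻¹ : ℂ) • (rankOneCompact (x + y) (x + y)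
      - rankOneCompact (x - y) (x - y)
      + Complex.I • rankOneCompact (x + Complex.I • y) (x + Complex.I • y)
      - Complex.I • rankOneCompact (x - Complex.I • y) (x - Complex.I • y)) := by
    apply Subtype.ext
    change rankOne ℂ x y = (4⁻¹ : ℂ) • (rankOne ℂ (x + y) (x + y) - rankOne ℂ (x - y) (x - y)
      + Complex.I • rankOne ℂ (x + Complex.I • y) (x + Complex.I • y)
      - Complex.I • rankOne ℂ (x - Complex.I • y) (x - Complex.I • y))
    ext z
    simp only [rankOne_apply, smul_apply, sub_apply,
      add_apply, inner_add_left, inner_sub_left, inner_smul_left,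
      Complex.conj_I]
    match_scalars
    · linear_combination ((1 / 2 : ℂ) * inner ℂ y z) * Complex.I_sq
    · linear_combination (-(1 / 2 : ℂ) * inner ℂ x z) * Complex.I_sq
  rw [h2]
  exact S.smul_mem _ (S.sub_mem (S.add_mem (S.sub_mem (h1 _) (h1 _)) (S.smul_mem _ (h1 _)))
    (S.smul_mem _ (h1 _)))

/-- `K(H)` is the closed linear span of the rank one projections. -/
theorem mem_of_rankOneCompact_mem {S : Submodule ℂ (compactOperators H)}
    (hS : IsClosed (S : Set (compactOperators H)))
    (h : ∀ x : H, ‖x‖ = 1 → rankOneCompact x x ∈ S) (k : compactOperators H) : k ∈ S := by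
  rw [← SetLike.mem_coe, ← hS.closure_eq]
  refine Metric.mem_closure_iff.2 fun ε hε => ?_
  obtain ⟨E, _, hE⟩ := exists_finiteDimensional_norm_sub_le (T := (k : H →L[ℂ] H)) k.2
    (half_pos hε)
  let b := stdOrthonormalBasis ℂ E
  -- With `P_E = ∑ |bᵢ⟩⟨bᵢ|`, the approximant `P_E k` equals `∑ |bᵢ⟩⟨k* bᵢ|`.
  refine ⟨∑ i, rankOneCompact (b i : H) (star (k : H →L[ℂ] H) (b i)), ?_, ?_⟩
  · exact S.sum_mem fun i _ => rankOneCompact_mem h _ _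
  · have h1 : ((∑ i, rankOneCompact (b i : H) (star (k : H →L[ℂ] H) (b i)) :
        compactOperators H) : H →L[ℂ] H) = E.starProjection * (k : H →L[ℂ] H) := by
      have : ((∑ i, rankOneCompact (b i : H) (star (k : H →L[ℂ] H) (b i)) :
        compactOperators H) : H →L[ℂ] H) =
          ∑ i, rankOne ℂ (b i : H) (star (k : H →L[ℂ] H) (b i)) :=
        AddSubmonoidClass.coe_finsetSum _ _
      rw [this, b.starProjection_eq_sum_rankOne]
      ext z
      simp [ContinuousLinearMap.star_eq_adjoint,
        ContinuousLinearMap.adjoint_inner_left]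
    rw [dist_eq_norm]
    change ‖(k : H →L[ℂ] H) - ((∑ i, rankOneCompact (b i : H) (star (k : H →L[ℂ] H) (b i)) :
        compactOperators H) : H →L[ℂ] H)‖ < ε
    rw [h1]
    linarith

end RankOne

/-! ### Transfer of minimal projections along homomorphisms -/

section Atoms

variable {A C : Type*} [NonUnitalCStarAlgebra A] [NonUnitalCStarAlgebra C]

/-- The kernel of a `*`-homomorphism. -/
def kerSubalgebra (φ : A →⋆ₙₐ[ℂ] C) : NonUnitalStarSubalgebra ℂ A :=
  (⊥ : NonUnitalStarSubalgebra ℂ C).comap φ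

theorem mem_kerSubalgebra {φ : A →⋆ₙₐ[ℂ] C} {a : A} : a ∈ kerSubalgebra φ ↔ φ a = 0 := by
  rw [kerSubalgebra, NonUnitalStarSubalgebra.mem_comap, NonUnitalStarAlgebra.mem_bot]

theorem NonUnitalStarAlgHom.continuous_of_cstar (φ : A →⋆ₙₐ[ℂ] C) : Continuous φ :=
  AddMonoidHomClass.continuous_of_bound φ 1 fun a => by
    rw [one_mul]; exact NonUnitalStarAlgHom.norm_apply_le φ a

theorem isClosed_kerSubalgebra (φ : A →⋆ₙₐ[ℂ] C) : IsClosed (kerSubalgebra φ : Set A) := by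
  have : (kerSubalgebra φ : Set A) = φ ⁻¹' {0} := by
    ext a; exact mem_kerSubalgebra
  rw [this]
  exact isClosed_singleton.preimage φ.continuous_of_cstar

/-- The kernel is an ideal, so `p b p` already lies in `B ∩ ker φ`, and compressing it once more by
`p` changes nothing. -/
theorem HasAtom.of_inf_kerSubalgebra {B : NonUnitalStarSubalgebra ℂ A} (φ : A →⋆ₙₐ[ℂ] C)
    (h : HasAtom (B ⊓ kerSubalgebra φ)) : HasAtom B := by
  obtain ⟨p, hp, hp0, hpp, hmin⟩ := h
  refine ⟨p, hp.1, hp0, hpp, fun b hb => ?_⟩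
  have hpb : p * b * p ∈ B ⊓ kerSubalgebra φ := by
    refine ⟨mul_mem (mul_mem hp.1 hb) hp.1, mem_kerSubalgebra.2 ?_⟩
    rw [map_mul, mem_kerSubalgebra.1 hp.2, mul_zero]
  obtain ⟨c, hc⟩ := hmin _ hpb
  refine ⟨c, ?_⟩
  have h1 : p * (p * b * p) * p = (p * p) * b * (p * p) := by simp only [mul_assoc]
  rwa [h1, hpp.isIdempotentElem.eq] at hc

theorem isometry_restrict {B : NonUnitalStarSubalgebra ℂ A} (hB : IsClosed (B : Set A))
    (φ : A →⋆ₙₐ[ℂ] C) (hinj : ∀ b ∈ B, φ b = 0 → b = 0) : ∀ b ∈ B, ‖φ b‖ = ‖b‖ := by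
  intro b hb
  have := hB
  let ψ : B →⋆ₙₐ[ℂ] C := φ.comp (NonUnitalStarSubalgebraClass.subtype B)
  have hψ : Function.Injective ψ := by
    rw [injective_iff_map_eq_zero]
    exact fun x hx => Subtype.ext (hinj x x.2 hx)
  exact NonUnitalStarAlgHom.norm_map ψ hψ ⟨b, hb⟩

theorem isClosed_map {B : NonUnitalStarSubalgebra ℂ A} (hB : IsClosed (B : Set A))
    (φ : A →⋆ₙₐ[ℂ] C) (hinj : ∀ b ∈ B, φ b = 0 → b = 0) :
    IsClosed ((B.map φ : NonUnitalStarSubalgebra ℂ C) : Set C) := by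
  have := hB
  let ψ : B →⋆ₙₐ[ℂ] C := φ.comp (NonUnitalStarSubalgebraClass.subtype B)
  have hψ : Isometry ψ :=
    AddMonoidHomClass.isometry_of_norm ψ fun b => isometry_restrict hB φ hinj b b.2
  have : ((B.map φ : NonUnitalStarSubalgebra ℂ C) : Set C) = Set.range ψ := by
    ext c
    constructor
    · rintro ⟨b, hb, rfl⟩; exact ⟨⟨b, hb⟩, rfl⟩
    · rintro ⟨b, rfl⟩; exact ⟨b, b.2, rfl⟩
  rw [this]
  exact hψ.isClosedEmbedding.isClosed_range

theorem HasAtom.of_map {B : NonUnitalStarSubalgebra ℂ A} (φ : A →⋆ₙₐ[ℂ] C)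
    (hinj : ∀ b ∈ B, φ b = 0 → b = 0) (h : HasAtom (B.map φ)) : HasAtom B := by
  have hinj' : ∀ a ∈ B, ∀ b ∈ B, φ a = φ b → a = b := fun a ha b hb hab =>
    sub_eq_zero.1 (hinj _ (sub_mem ha hb) (by rw [map_sub, hab, sub_self]))
  obtain ⟨_, ⟨p, hp, rfl⟩, hp0, hpp, hmin⟩ := h
  refine ⟨p, hp, fun h => hp0 (by rw [h]; exact map_zero φ), ⟨?_, ?_⟩, fun b hb => ?_⟩
  · refine hinj' _ (mul_mem hp hp) _ hp ?_
    rw [map_mul]; exact hpp.isIdempotentElem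
  · refine hinj' _ (star_mem hp) _ hp ?_
    rw [map_star]; exact hpp.isSelfAdjoint
  · obtain ⟨c, hc⟩ := hmin (φ b) ⟨b, hb, rfl⟩
    refine ⟨c, hinj' _ (mul_mem (mul_mem hp hb) hp) _ (SMulMemClass.smul_mem c hp) ?_⟩
    rw [map_mul, map_mul, map_smul]; exact hc

/-- A closed `*`-subalgebra `B` has an atom if both `B ∩ ker φ` and (in case `φ` is injective on
`B`) `φ(B)` have one. -/
theorem HasAtom.of_hom {B : NonUnitalStarSubalgebra ℂ A} (hB : IsClosed (B : Set A))
    (hne : ∃ b ∈ B, b ≠ 0) (φ : A →⋆ₙₐ[ℂ] C)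
    (hmap : IsClosed ((B.map φ : NonUnitalStarSubalgebra ℂ C) : Set C) →
      (∃ c ∈ B.map φ, c ≠ 0) → HasAtom (B.map φ))
    (hker : IsClosed ((B ⊓ kerSubalgebra φ : NonUnitalStarSubalgebra ℂ A) : Set A) →
      (∃ b ∈ B ⊓ kerSubalgebra φ, b ≠ 0) → HasAtom (B ⊓ kerSubalgebra φ)) : HasAtom B := by
  by_cases hinj : ∀ b ∈ B, φ b = 0 → b = 0
  · refine .of_map φ hinj (hmap (isClosed_map hB φ hinj) ?_)
    obtain ⟨b, hb, hb0⟩ := hne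
    exact ⟨φ b, ⟨b, hb, rfl⟩, fun h => hb0 (hinj b hb h)⟩
  · push Not at hinj
    obtain ⟨b, hb, hφ, hb0⟩ := hinj
    exact .of_inf_kerSubalgebra φ (hker (hB.inter (isClosed_kerSubalgebra φ))
      ⟨b, ⟨hb, mem_kerSubalgebra.2 hφ⟩, hb0⟩)

theorem HasAtom.of_complex {B : NonUnitalStarSubalgebra ℂ ℂ} (hne : ∃ b ∈ B, b ≠ 0) :
    HasAtom B := by
  obtain ⟨b, hb, hb0⟩ := hne
  refine ⟨1, ?_, one_ne_zero, IsStarProjection.one ℂ, fun b _ => ⟨b, by simp⟩⟩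
  have := B.smul_mem b⁻¹ hb
  rwa [smul_eq_mul, inv_mul_cancel₀ hb0] at this

theorem isScattered_of_hasAtom
    (h : ∀ B : NonUnitalStarSubalgebra ℂ A, IsClosed (B : Set A) → (∃ b ∈ B, b ≠ 0) → HasAtom B) :
    IsScattered A := by
  intro B hB hne heq
  obtain ⟨p, hp, hp0, hpp, hmin⟩ := h B hB hne
  have hP : IsMinimalProjection (⟨p, hp⟩ : B) := by
    refine ⟨fun h => hp0 (congrArg Subtype.val h), ⟨Subtype.ext hpp.1, Subtype.ext hpp.2⟩, ?_⟩
    ext x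
    constructor
    · rintro ⟨b, rfl⟩
      obtain ⟨c, hc⟩ := hmin b b.2
      exact ⟨c, Subtype.ext hc.symm⟩
    · rintro ⟨c, rfl⟩
      refine ⟨c • ⟨p, hp⟩, Subtype.ext ?_⟩
      change p * (c • p) * p = c • p
      rw [mul_smul_comm, hpp.1.eq, smul_mul_assoc, hpp.1.eq]
  have : (⟨p, hp⟩ : B) ∈ atomIdeal B := subset_closure (NonUnitalStarAlgebra.subset_adjoin ℂ _ hP)
  rw [heq] at this
  exact hp0 (congrArg Subtype.val (Set.mem_singleton_iff.1 this))

end Atoms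

/-! ### Point masses and truncations on `ω + 1` -/

section FunctionsOnOmegaPlusOne

section Group

variable {Y : Type*} [NormedAddCommGroup Y]

/-- The function on `ω + 1` with value `b` at `n` and `0` elsewhere. -/
def pointMass (n : ℕ) (b : Y) : C(OmegaPlusOne, Y) :=
  OnePoint.continuousMapMkNat (fun m => if m = n then b else 0) 0
    (tendsto_const_nhds.congr' ((eventually_gt_atTop n).mono fun _ hm => (if_neg hm.ne').symm))

theorem pointMass_apply (n : ℕ) (b : Y) (m : ℕ) :
    pointMass n b (m : OmegaPlusOne) = if m = n then b else 0 := rfl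

theorem pointMass_self (n : ℕ) (b : Y) : pointMass n b (n : OmegaPlusOne) = b := if_pos rfl

theorem pointMass_infty (n : ℕ) (b : Y) : pointMass n b (OnePoint.infty : OmegaPlusOne) = 0 := rfl

theorem tendsto_apply_infty (f : C(OmegaPlusOne, Y)) :
    Tendsto (fun n : ℕ => f (n : OmegaPlusOne)) atTop (𝓝 (f OnePoint.infty)) :=
  (OnePoint.continuous_iff_from_nat f).1 f.continuous

theorem ext_omega {f g : C(OmegaPlusOne, Y)} (h : ∀ n : ℕ, f (n : OmegaPlusOne) = g n) : f = g := by
  ext x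
  induction x using OnePoint.rec with
  | infty => exact tendsto_nhds_unique ((tendsto_apply_infty f).congr h) (tendsto_apply_infty g)
  | coe n => exact h n

/-- The function which agrees with `f` below `N` and at `∞`, and is constant from `N` on. -/
def truncate (N : ℕ) (f : C(OmegaPlusOne, Y)) : C(OmegaPlusOne, Y) :=
  ContinuousMap.const _ (f OnePoint.infty) +
    ∑ n ∈ Finset.range N, pointMass n (f n - f OnePoint.infty)

theorem truncate_apply (N : ℕ) (f : C(OmegaPlusOne, Y)) (m : ℕ) :
    truncate N f (m : OmegaPlusOne) = if m < N then f m else f OnePoint.infty := by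
  simp only [truncate, ContinuousMap.add_apply, ContinuousMap.const_apply, ContinuousMap.sum_apply,
    pointMass_apply, Finset.sum_ite_eq, Finset.mem_range]
  split_ifs <;> simp

theorem truncate_infty (N : ℕ) (f : C(OmegaPlusOne, Y)) :
    truncate N f OnePoint.infty = f OnePoint.infty := by
  simp [truncate, ContinuousMap.sum_apply, pointMass_infty]

theorem tendsto_truncate (f : C(OmegaPlusOne, Y)) :
    Tendsto (fun N => truncate N f) atTop (𝓝 f) := by
  rw [Metric.tendsto_atTop]
  intro ε hε
  obtain ⟨N, hN⟩ := Metric.tendsto_atTop.1 (tendsto_apply_infty f) (ε / 2) (half_pos hε)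
  refine ⟨N, fun M hM => lt_of_le_of_lt ?_ (half_lt_self hε)⟩
  refine (ContinuousMap.dist_le (half_pos hε).le).2 fun x => ?_
  induction x using OnePoint.rec with
  | infty => rw [truncate_infty, dist_self]; exact (half_pos hε).le
  | coe n =>
    rw [truncate_apply]
    split_ifs with h
    · rw [dist_self]; exact (half_pos hε).le
    · rw [dist_comm]; exact (hN n (hM.trans (not_lt.1 h))).le

/-- Truncations converge uniformly to `f`, and each is a constant plus finitely many point masses.
All later spanning arguments rest on this. -/
theorem mem_of_pointMass_mem {S : AddSubgroup C(OmegaPlusOne, Y)}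
    (hS : IsClosed (S : Set C(OmegaPlusOne, Y))) {f : C(OmegaPlusOne, Y)}
    (hconst : ContinuousMap.const _ (f OnePoint.infty) ∈ S)
    (h : ∀ n : ℕ, pointMass n (f n - f OnePoint.infty) ∈ S) : f ∈ S :=
  hS.mem_of_tendsto (tendsto_truncate f) (Eventually.of_forall fun _ =>
    S.add_mem hconst (S.sum_mem fun n _ => h n))

theorem pointMass_sub (n : ℕ) (b c : Y) : pointMass n (b - c) = pointMass n b - pointMass n c := by
  refine ext_omega fun m => ?_
  rw [ContinuousMap.sub_apply]
  simp only [pointMass_apply]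
  split_ifs <;> simp

theorem pointMass_add (n : ℕ) (b c : Y) : pointMass n (b + c) = pointMass n b + pointMass n c := by
  refine ext_omega fun m => ?_
  rw [ContinuousMap.add_apply]
  simp only [pointMass_apply]
  split_ifs <;> simp

theorem norm_pointMass_le (n : ℕ) (b : Y) : ‖pointMass n b‖ ≤ ‖b‖ := by
  refine (ContinuousMap.norm_le _ (norm_nonneg b)).2 fun x => ?_
  induction x using OnePoint.rec with
  | infty => rw [pointMass_infty, norm_zero]; exact norm_nonneg b
  | coe m => rw [pointMass_apply]; split_ifs <;> simp

/-- `b ↦ δₙ b` as an additive homomorphism. -/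
def pointMassHom (n : ℕ) : Y →+ C(OmegaPlusOne, Y) :=
  AddMonoidHom.mk' (pointMass n) (pointMass_add n)

theorem continuous_pointMass (n : ℕ) : Continuous (pointMass n : Y → C(OmegaPlusOne, Y)) :=
  AddMonoidHomClass.continuous_of_bound (pointMassHom n) 1 fun b => by
    rw [one_mul]; exact norm_pointMass_le n b

end Group

section Ring

variable {Y : Type*} [NormedRing Y]

theorem mul_pointMass (f : C(OmegaPlusOne, Y)) (n : ℕ) (b : Y) :
    f * pointMass n b = pointMass n (f n * b) := by
  refine ext_omega fun m => ?_
  rw [ContinuousMap.mul_apply]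
  simp only [pointMass_apply]
  split_ifs with h
  · rw [h]
  · rw [mul_zero]

theorem pointMass_mul (f : C(OmegaPlusOne, Y)) (n : ℕ) (b : Y) :
    pointMass n b * f = pointMass n (b * f n) := by
  refine ext_omega fun m => ?_
  rw [ContinuousMap.mul_apply]
  simp only [pointMass_apply]
  split_ifs with h
  · rw [h]
  · rw [zero_mul]

end Ring

theorem smul_pointMass {Y : Type*} [NormedAddCommGroup Y] [NormedSpace ℂ Y] (c : ℂ) (n : ℕ)
    (b : Y) : c • pointMass n b = pointMass n (c • b) := by
  refine ext_omega fun m => ?_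
  rw [ContinuousMap.smul_apply]
  simp only [pointMass_apply]
  split_ifs <;> simp

theorem star_pointMass {Y : Type*} [NormedRing Y] [StarRing Y] [CStarRing Y] (n : ℕ)
    (b : Y) : star (pointMass n b) = pointMass n (star b) := by
  refine ext_omega fun m => ?_
  rw [ContinuousMap.star_apply]
  simp only [pointMass_apply]
  split_ifs <;> simp

end FunctionsOnOmegaPlusOne

/-! ### Minimal projections in subalgebras of `C(ω + 1, Y)` -/

section Scattered

variable {Y : Type*} [CStarAlgebra Y]

/-- Evaluation at a point. -/
def evalHom (x : OmegaPlusOne) : C(OmegaPlusOne, Y) →⋆ₙₐ[ℂ] Y where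
  toFun f := f x
  map_smul' _ _ := rfl
  map_zero' := rfl
  map_add' _ _ := rfl
  map_mul' _ _ := rfl
  map_star' _ := rfl

theorem evalHom_apply (x : OmegaPlusOne) (f : C(OmegaPlusOne, Y)) : evalHom x f = f x := rfl

/-- The map `n ↦ n + N` of `ω + 1`. -/
def shiftMap (N : ℕ) : C(OmegaPlusOne, OmegaPlusOne) :=
  OnePoint.continuousMapMkNat (fun n => ((n + N : ℕ) : OmegaPlusOne)) OnePoint.infty
    (((OnePoint.continuous_iff_from_nat id).1 continuous_id).comp (tendsto_add_atTop_nat N))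

/-- Composition with `n ↦ n + N`. -/
def shiftHom (N : ℕ) : C(OmegaPlusOne, Y) →⋆ₙₐ[ℂ] C(OmegaPlusOne, Y) where
  toFun f := f.comp (shiftMap N)
  map_smul' _ _ := rfl
  map_zero' := rfl
  map_add' _ _ := rfl
  map_mul' _ _ := rfl
  map_star' _ := rfl

theorem shiftHom_apply (N : ℕ) (f : C(OmegaPlusOne, Y)) (n : ℕ) :
    shiftHom N f (n : OmegaPlusOne) = f ((n + N : ℕ) : OmegaPlusOne) := rfl

theorem shiftHom_infty (N : ℕ) (f : C(OmegaPlusOne, Y)) :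
    shiftHom N f OnePoint.infty = f OnePoint.infty := rfl

theorem tendsto_norm_shiftHom {f : C(OmegaPlusOne, Y)} (hf : f OnePoint.infty = 0) :
    Tendsto (fun N => ‖shiftHom N f‖) atTop (𝓝 0) := by
  rw [Metric.tendsto_atTop]
  intro ε hε
  obtain ⟨N, hN⟩ := Metric.tendsto_atTop.1 (tendsto_apply_infty f) (ε / 2) (half_pos hε)
  refine ⟨N, fun M hM => lt_of_le_of_lt ?_ (half_lt_self hε)⟩
  rw [dist_zero_right, Real.norm_of_nonneg (norm_nonneg _)]
  refine (ContinuousMap.norm_le _ (half_pos hε).le).2 fun x => ?_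
  induction x using OnePoint.rec with
  | infty => rw [shiftHom_infty, hf, norm_zero]; exact (half_pos hε).le
  | coe n =>
    have := hN (n + M) (by omega)
    rw [hf, dist_zero_right] at this
    exact this.le

/-- Functions killed by the shift by `N` live on the points below `N`. The induction removes the
last of these points by evaluating there. -/
theorem HasAtom.of_le_ker_shiftHom (N : ℕ) {B : NonUnitalStarSubalgebra ℂ C(OmegaPlusOne, Y)}
    (hB : IsClosed (B : Set C(OmegaPlusOne, Y))) (hle : ∀ f ∈ B, shiftHom N f = 0)
    (hY : ∀ D : NonUnitalStarSubalgebra ℂ Y, IsClosed (D : Set Y) → (∃ b ∈ D, b ≠ 0) → HasAtom D)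
    (hne : ∃ b ∈ B, b ≠ 0) : HasAtom B := by
  induction N generalizing B with
  | zero =>
    obtain ⟨f, hf, hf0⟩ := hne
    refine absurd (ext_omega fun n => ?_) hf0
    have : shiftHom 0 f (n : OmegaPlusOne) = 0 := by rw [hle f hf]; rfl
    exact this
  | succ N ih =>
    refine .of_hom hB hne (evalHom N) (hY _) fun hc h =>
      ih hc (fun f hf => ext_omega fun n => ?_) h
    rcases n with _ | n
    · rw [shiftHom_apply, zero_add]
      exact mem_kerSubalgebra.1 hf.2
    · have := congrArg (fun g : C(OmegaPlusOne, Y) => g n) (hle f hf.1)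
      rw [shiftHom_apply, show n + 1 + N = n + (N + 1) by ring]
      exact this

/-- If all nonzero closed `*`-subalgebras of `Y` have atoms then so do those of `C(ω + 1, Y)`. -/
theorem HasAtom.of_continuousMap
    (hY : ∀ D : NonUnitalStarSubalgebra ℂ Y, IsClosed (D : Set Y) → (∃ b ∈ D, b ≠ 0) → HasAtom D)
    {B : NonUnitalStarSubalgebra ℂ C(OmegaPlusOne, Y)}
    (hB : IsClosed (B : Set C(OmegaPlusOne, Y))) (hne : ∃ b ∈ B, b ≠ 0) :
    HasAtom B := by
  refine .of_hom hB hne (evalHom OnePoint.infty) (hY _)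
    fun hB' hne' => ?_
  -- Here all functions vanish at `∞`, so the norms of their shifts tend to `0`. Shifts injective on
  -- the algebra would be isometric, so some shift has a nonzero kernel.
  by_cases hinj : ∀ N, ∀ f ∈ B ⊓ kerSubalgebra (evalHom OnePoint.infty), shiftHom N f = 0 → f = 0
  · obtain ⟨f, hf, hf0⟩ := hne'
    have h1 : ∀ N, ‖shiftHom N f‖ = ‖f‖ := fun N => isometry_restrict hB' _ (hinj N) f hf
    have h2 := tendsto_norm_shiftHom (f := f) (mem_kerSubalgebra.1 hf.2)
    simp only [h1] at h2
    exact absurd (norm_eq_zero.1 (tendsto_nhds_unique tendsto_const_nhds h2)) hf0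
  · push Not at hinj
    obtain ⟨N, f, hf, hfN, hf0⟩ := hinj
    exact .of_inf_kerSubalgebra (shiftHom N) (.of_le_ker_shiftHom N
      (hB'.inter (isClosed_kerSubalgebra _)) (fun g hg => mem_kerSubalgebra.1 hg.2)
      hY ⟨f, ⟨hf, mem_kerSubalgebra.2 hfN⟩, hf0⟩)

end Scattered

/-! ### Minimal projections of quotients -/

section MinimalProjections

theorem isMinimalProjection_iff {A : Type*} [NonUnitalRing A] [StarRing A] [Module ℂ A]
    [IsScalarTower ℂ A A] [SMulCommClass ℂ A A] {p : A} :
    IsMinimalProjection p ↔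
      p ≠ 0 ∧ p * p = p ∧ star p = p ∧ ∀ a, ∃ c : ℂ, p * a * p = c • p := by
  constructor
  · rintro ⟨h0, hp, h⟩
    refine ⟨h0, hp.1, hp.2, fun a => ?_⟩
    have : p * a * p ∈ Set.range (fun c : ℂ => c • p) := h ▸ ⟨a, rfl⟩
    obtain ⟨c, hc⟩ := this
    exact ⟨c, hc.symm⟩
  · rintro ⟨h0, hp, hs, h⟩
    refine ⟨h0, ⟨hp, hs⟩, Set.Subset.antisymm ?_ ?_⟩
    · rintro _ ⟨a, rfl⟩
      obtain ⟨c, hc⟩ := h a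
      exact ⟨c, hc.symm⟩
    · rintro _ ⟨c, rfl⟩
      exact ⟨c • p, by simp only [mul_smul_comm, smul_mul_assoc, hp]⟩

namespace ClosedIdeal

variable {A : Type u} [NonUnitalCStarAlgebra A] (I : ClosedIdeal A)

theorem Quot.mk_eq_zero_iff {a : A} : Quot.mk I a = 0 ↔ a ∈ I := by
  rw [← Quot.mk_zero, Quot.mk_eq_mk_iff, sub_zero]

theorem isMinimalProjection_mk_iff {p : A} :
    IsMinimalProjection (Quot.mk I p) ↔
      p ∉ I ∧ p * p - p ∈ I ∧ star p - p ∈ I ∧ ∀ a, ∃ c : ℂ, p * a * p - c • p ∈ I := by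
  rw [isMinimalProjection_iff, Ne, Quot.mk_eq_zero_iff, ← Quot.mk_mul, Quot.mk_eq_mk_iff,
    ← Quot.mk_star, Quot.mk_eq_mk_iff, (Quot.mk_surjective I).forall]
  simp only [← Quot.mk_mul, ← Quot.mk_smul, Quot.mk_eq_mk_iff]

theorem Quot.isQuotientMap_mk : IsQuotientMap (Quot.mk I) := isQuotientMap_quot_mk

/-- The class map as a linear map. -/
def Quot.mkₗ : A →ₗ[ℂ] I.Quot where
  toFun := Quot.mk I
  map_add' := Quot.mk_add I
  map_smul' := Quot.mk_smul I

instance : IsTopologicalAddGroup I.Quot :=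
  inferInstanceAs (IsTopologicalAddGroup (A ⧸ I.toSubmodule))

instance : ContinuousConstSMul ℂ I.Quot :=
  inferInstanceAs (ContinuousConstSMul ℂ (A ⧸ I.toSubmodule))

/-- The elements of `A` whose class lies in `I^At(A / I)`. -/
def atomSubmodule : Submodule ℂ A :=
  (NonUnitalStarAlgebra.adjoin ℂ {p : I.Quot |
    IsMinimalProjection p}).toSubmodule.topologicalClosure.comap (Quot.mkₗ I)

theorem mem_atomSubmodule {a : A} : a ∈ I.atomSubmodule ↔ Quot.mk I a ∈ atomIdeal I.Quot := Iff.rfl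

theorem isClosed_atomSubmodule : IsClosed (I.atomSubmodule : Set A) :=
  isClosed_closure.preimage (Quot.isQuotientMap_mk I).continuous

/-- The image of an ideal in the quotient. -/
def mapQuot (J : ClosedIdeal A) : NonUnitalStarSubalgebra ℂ I.Quot where
  carrier := Quot.mk I '' (J : Set A)
  zero_mem' := ⟨0, J.toSubmodule.zero_mem, rfl⟩
  add_mem' := by
    rintro _ _ ⟨a, ha, rfl⟩ ⟨b, hb, rfl⟩
    exact ⟨a + b, J.toSubmodule.add_mem ha hb, rfl⟩
  mul_mem' := by
    rintro _ _ ⟨a, ha, rfl⟩ ⟨b, hb, rfl⟩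
    exact ⟨a * b, J.mul_mem_left' a hb, rfl⟩
  smul_mem' := by
    rintro c _ ⟨a, ha, rfl⟩
    exact ⟨c • a, J.toSubmodule.smul_mem c ha, rfl⟩
  star_mem' := by
    rintro _ ⟨a, ha, rfl⟩
    exact ⟨star a, J.star_mem' ha, rfl⟩

variable {I}

theorem mk_mem_image_iff {J : ClosedIdeal A} (hIJ : I ≤ J) {a : A} :
    Quot.mk I a ∈ Quot.mk I '' (J : Set A) ↔ a ∈ J := by
  constructor
  · rintro ⟨b, hb, hab⟩
    have h1 : b - a ∈ J := hIJ ((Quot.mk_eq_mk_iff I b a).1 hab)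
    have h2 := J.toSubmodule.sub_mem hb h1
    rwa [sub_sub_cancel] at h2
  · exact fun h => ⟨a, h, rfl⟩

theorem isClosed_image_mk {J : ClosedIdeal A} (hIJ : I ≤ J) :
    IsClosed (Quot.mk I '' (J : Set A)) := by
  rw [← (Quot.isQuotientMap_mk I).isClosed_preimage]
  have : Quot.mk I ⁻¹' (Quot.mk I '' (J : Set A)) = J := by
    ext a; exact mk_mem_image_iff hIJ
  rw [this]
  exact J.isClosed'

/-- Moves the computation of `I^At(A / I)` to lifts in `A`: the image of `J` is a closed
`*`-subalgebra, and the preimage of `I^At(A / I)` is a closed subspace containing `I`. -/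
theorem atomIdeal_quot_eq {J : ClosedIdeal A} (hIJ : I ≤ J)
    (hmem : ∀ p, IsMinimalProjection (Quot.mk I p) → p ∈ J)
    (hspan : ∀ S : Submodule ℂ A, IsClosed (S : Set A) → (∀ a ∈ I, a ∈ S) →
      (∀ p, IsMinimalProjection (Quot.mk I p) → p ∈ S) → ∀ a ∈ J, a ∈ S) :
    atomIdeal I.Quot = Quot.mk I '' (J : Set A) := by
  apply Set.Subset.antisymm
  · refine closure_minimal ?_ (isClosed_image_mk hIJ)
    have : NonUnitalStarAlgebra.adjoin ℂ {p : I.Quot | IsMinimalProjection p} ≤ I.mapQuot J := by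
      refine NonUnitalStarAlgebra.adjoin_le fun p hp => ?_
      obtain ⟨p, rfl⟩ := Quot.mk_surjective I p
      exact ⟨p, hmem p hp, rfl⟩
    exact this
  · rintro _ ⟨a, ha, rfl⟩
    refine hspan I.atomSubmodule I.isClosed_atomSubmodule (fun a ha => ?_) (fun p hp => ?_) a ha
    · rw [mem_atomSubmodule, (Quot.mk_eq_zero_iff I).2 ha]
      exact subset_closure (zero_mem (NonUnitalStarAlgebra.adjoin ℂ _))
    · exact subset_closure (NonUnitalStarAlgebra.subset_adjoin ℂ _ hp)

/-- A minimal projection of `A / I` whose class does not lie in the ideal `J / I` annihilates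
that ideal. -/
theorem mul_mul_mem_of_isMinimalProjection {J : ClosedIdeal A} (hIJ : I ≤ J) {p : A}
    (hp : IsMinimalProjection (Quot.mk I p)) (hpJ : p ∉ J) {k : A} (hk : k ∈ J) :
    p * k * p ∈ I := by
  obtain ⟨-, -, -, h⟩ := (isMinimalProjection_mk_iff I).1 hp
  obtain ⟨c, hc⟩ := h k
  have h1 : p * k * p ∈ J := J.mul_mem_right' p (J.mul_mem_left' p hk)
  have h2 : c • p ∈ J := by
    have := J.toSubmodule.sub_mem h1 (hIJ hc)
    rwa [sub_sub_cancel] at this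
  have hc0 : c = 0 := by
    by_contra hc0
    have := J.toSubmodule.smul_mem c⁻¹ h2
    rw [smul_smul, inv_mul_cancel₀ hc0, one_smul] at this
    exact hpJ this
  rwa [hc0, zero_smul, sub_zero] at hc

end ClosedIdeal

end MinimalProjections

/-! ### Uniqueness of Cantor–Bendixson sequences of finite height -/

section Uniqueness

variable {A : Type u} [NonUnitalCStarAlgebra A]

/-- Since `I α ≤ I (α + 1)`, the next ideal is the full preimage of `I^At(A / I α)` and is thus
determined by `I α`. -/
theorem IsCantorBendixsonSequence.mem_succ_iff {θ : Ordinal.{u}} {I : Ordinal.{u} → ClosedIdeal A}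
    (h : IsCantorBendixsonSequence A θ I) {α : Ordinal.{u}} (hα : α < θ) (a : A) :
    a ∈ I (Order.succ α) ↔ ClosedIdeal.Quot.mk (I α) a ∈ atomIdeal (I α).Quot := by
  rw [h.derivative α hα, ClosedIdeal.mk_mem_image_iff]
  exact (h.strictMono α _ (Order.lt_succ α) (Order.succ_le_of_lt hα)).le

theorem IsCantorBendixsonSequence.natCast_eq {θ θ' : Ordinal.{u}}
    {I I' : Ordinal.{u} → ClosedIdeal A} (h : IsCantorBendixsonSequence A θ I)
    (h' : IsCantorBendixsonSequence A θ' I') (n : ℕ) (hn : (n : Ordinal.{u}) ≤ θ)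
    (hn' : (n : Ordinal.{u}) ≤ θ') : I n = I' n := by
  induction n with
  | zero => rw [Nat.cast_zero, h.zero, h'.zero]
  | succ n ih =>
    have hlt : (n : Ordinal.{u}) < (n + 1 : ℕ) := Nat.cast_lt.2 n.lt_succ_self
    have e : ((n + 1 : ℕ) : Ordinal.{u}) = Order.succ (n : Ordinal.{u}) := by
      rw [Nat.cast_succ, Order.succ_eq_add_one]
    have hI := ih (hlt.le.trans hn) (hlt.le.trans hn')
    refine SetLike.ext fun a => ?_
    rw [e, h.mem_succ_iff (hlt.trans_le hn), h'.mem_succ_iff (hlt.trans_le hn'), hI]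

/-- At the smaller of two heights the common ideal is already all of `A`, and strict monotonicity
forbids going on. One height is finite, so agreement at finite stages is enough. -/
theorem IsCantorBendixsonSequence.height_eq {θ : Ordinal.{u}} {n : ℕ}
    {I I' : Ordinal.{u} → ClosedIdeal A} (h : IsCantorBendixsonSequence A θ I)
    (h' : IsCantorBendixsonSequence A n I') : θ = n := by
  rcases lt_trichotomy θ n with hlt | heq | hlt
  · obtain ⟨m, rfl⟩ := Ordinal.lt_omega0.1 (hlt.trans (Ordinal.natCast_lt_omega0 n))
    have h1 := h'.strictMono _ _ hlt le_rfl
    rw [← h.natCast_eq h' m le_rfl hlt.le, h.top, h'.top] at h1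
    exact absurd h1 (lt_irrefl _)
  · exact heq
  · have h1 := h.strictMono _ _ hlt le_rfl
    rw [h.natCast_eq h' n hlt.le le_rfl, h.top, h'.top] at h1
    exact absurd h1 (lt_irrefl _)

/-- A finite chain of ideals, each the Cantor–Bendixson derivative of the previous one, is a
Cantor–Bendixson sequence. -/
theorem isCantorBendixsonSequence_of_nat {J : ℕ → ClosedIdeal A} (n : ℕ) (h0 : J 0 = ⊥)
    (htop : J n = ⊤) (hlt : ∀ m < n, J m < J (m + 1))
    (hder : ∀ m < n, atomIdeal (J m).Quot =
      ClosedIdeal.Quot.mk (J m) '' (J (m + 1) : Set A)) :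
    IsCantorBendixsonSequence A n (fun α => J (Cardinal.toNat α.card)) := by
  -- The index `Cardinal.toNat α.card` is `m` at the ordinal `m`; its values above `n` play no role.
  have hJ : ∀ m : ℕ, J (Cardinal.toNat (m : Ordinal.{u}).card) = J m := fun m => by simp
  have hnat : ∀ α ≤ (n : Ordinal.{u}), ∃ m : ℕ, α = m ∧ m ≤ n := fun α hα => by
    obtain ⟨m, rfl⟩ := Ordinal.lt_omega0.1 (hα.trans_lt (Ordinal.natCast_lt_omega0 n))
    exact ⟨m, rfl, Nat.cast_le.1 hα⟩
  refine ⟨?_, ?_, fun α β hαβ hβ => ?_, fun α hα hlim => ?_, fun α hα => ?_⟩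
  · rw [← h0, ← hJ 0, Nat.cast_zero]
  · rw [← htop, ← hJ n]
  · obtain ⟨b, rfl, hb⟩ := hnat β hβ
    obtain ⟨a, rfl, -⟩ := hnat α (hαβ.le.trans hβ)
    have hab : a < b := Nat.cast_lt.1 hαβ
    simp only [hJ]
    clear hαβ hβ
    induction b, hab using Nat.le_induction with
    | base => exact hlt a (by omega)
    | succ b hab ih => exact (ih (by omega)).trans (hlt b (by omega))
  · obtain ⟨a, rfl, -⟩ := hnat α hα
    rcases a with _ | a
    · exact absurd hlim.not_isMin (by simp)
    · rw [Nat.cast_succ, ← Order.succ_eq_add_one] at hlim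
      exact absurd hlim (Order.not_isSuccLimit_succ _)
  · obtain ⟨a, rfl, -⟩ := hnat α hα.le
    have e : J (Cardinal.toNat (Order.succ (a : Ordinal.{u})).card) = J (a + 1) := by
      rw [Order.succ_eq_add_one, ← Nat.cast_succ, hJ]
    change atomIdeal (J (Cardinal.toNat (a : Ordinal.{u}).card)).Quot = _ '' _
    rw [e, hJ a]
    exact hder a (Nat.cast_lt.1 hα)

end Uniqueness

/-! ### The Cantor–Bendixson sequence of `C(ω + 1, Y)` -/

section Derivatives

variable {Y : Type u} [CStarAlgebra Y]

/-- The kernel of the character `σ` is an essential ideal which is the closed linear span of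
minimal projections. -/
structure IsAtomicEssentialCharacter (σ : Y →⋆ₐ[ℂ] ℂ) : Prop where
  essential : ∀ a, IsSelfAdjoint a → (∀ k, σ k = 0 → a * k * a = 0) → a = 0
  span : ∀ S : Submodule ℂ Y, IsClosed (S : Set Y) →
    (∀ q, IsMinimalProjection q → σ q = 0 → q ∈ S) → ∀ k, σ k = 0 → k ∈ S
  exists_minimal : ∃ q, IsMinimalProjection q ∧ σ q = 0

theorem StarAlgHom.continuous_character (σ : Y →⋆ₐ[ℂ] ℂ) : Continuous σ :=
  NonUnitalStarAlgHom.continuous_of_cstar (σ : Y →⋆ₙₐ[ℂ] ℂ)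

variable (σ : Y →⋆ₐ[ℂ] ℂ)

/-- The functions with values in `ker σ` which vanish at `∞`. -/
def vanishingIdeal : ClosedIdeal C(OmegaPlusOne, Y) where
  carrier := {f | (∀ n : ℕ, σ (f n) = 0) ∧ f OnePoint.infty = 0}
  zero_mem' := ⟨fun _ => map_zero σ, rfl⟩
  add_mem' := by
    rintro f g ⟨hf, hf'⟩ ⟨hg, hg'⟩
    exact ⟨fun n => by simp [hf n, hg n], by simp [hf', hg']⟩
  smul_mem' := by
    rintro c f ⟨hf, hf'⟩
    exact ⟨fun n => by simp [hf n], by simp [hf']⟩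
  mul_mem_left' := by
    rintro g f ⟨hf, hf'⟩
    exact ⟨fun n => by simp [hf n], by simp [hf']⟩
  mul_mem_right' := by
    rintro g f ⟨hf, hf'⟩
    exact ⟨fun n => by simp [hf n], by simp [hf']⟩
  star_mem' := by
    rintro f ⟨hf, hf'⟩
    exact ⟨fun n => by simp [map_star, hf n], by simp [hf']⟩
  isClosed' := by
    have h1 : ∀ x : OmegaPlusOne, Continuous fun f : C(OmegaPlusOne, Y) => f x :=
      fun x => continuous_eval_const x
    have h2 : IsClosed {f : C(OmegaPlusOne, Y) | ∀ n : ℕ, σ (f n) = 0} := by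
      rw [Set.ofPred_forall]
      exact isClosed_iInter fun n =>
        isClosed_eq (σ.continuous_character.comp (h1 n)) continuous_const
    exact h2.inter (isClosed_eq (h1 _) continuous_const)

/-- The functions with value in `ker σ` at `∞`. -/
def limitIdeal : ClosedIdeal C(OmegaPlusOne, Y) where
  carrier := {f | σ (f OnePoint.infty) = 0}
  zero_mem' := map_zero σ
  add_mem' := by
    intro f g (hf : σ _ = 0) (hg : σ _ = 0)
    change σ _ = 0
    simp [hf, hg]
  smul_mem' := by
    intro c f (hf : σ _ = 0)
    change σ _ = 0
    simp [hf]
  mul_mem_left' := by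
    intro c f (hf : σ _ = 0)
    change σ _ = 0
    simp [hf]
  mul_mem_right' := by
    intro c f (hf : σ _ = 0)
    change σ _ = 0
    simp [hf]
  star_mem' := by
    intro f (hf : σ _ = 0)
    change σ _ = 0
    simp [map_star, hf]
  isClosed' := isClosed_eq
    (σ.continuous_character.comp (continuous_eval_const _)) continuous_const

variable {σ}

theorem mem_limitIdeal {f : C(OmegaPlusOne, Y)} :
    f ∈ limitIdeal σ ↔ σ (f OnePoint.infty) = 0 := Iff.rfl

theorem ClosedIdeal.mem_bot {A : Type*} [NonUnitalCStarAlgebra A] {a : A} :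
    a ∈ (⊥ : ClosedIdeal A) ↔ a = 0 := Iff.rfl

theorem pointMass_mem_limitIdeal (n : ℕ) (b : Y) : pointMass n b ∈ limitIdeal σ := by
  rw [mem_limitIdeal, pointMass_infty, map_zero]

theorem pointMass_mem_vanishingIdeal (n : ℕ) {b : Y} (hb : σ b = 0) :
    pointMass n b ∈ vanishingIdeal σ := by
  refine ⟨fun m => ?_, rfl⟩
  rw [pointMass_apply]
  split_ifs
  · exact hb
  · exact map_zero σ

/-- `b ↦ δₙ b` as a linear map. -/
def pointMassLinear (n : ℕ) : Y →ₗ[ℂ] C(OmegaPlusOne, Y) where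
  toFun := pointMass n
  map_add' := pointMass_add n
  map_smul' c b := (smul_pointMass c n b).symm

/-- The inclusion of the constant functions as a linear map. -/
def constLinear : Y →ₗ[ℂ] C(OmegaPlusOne, Y) where
  toFun b := ContinuousMap.const OmegaPlusOne b
  map_add' _ _ := rfl
  map_smul' _ _ := rfl

open ClosedIdeal

theorem isMinimalProjection_mk_bot_pointMass (n : ℕ) {q : Y} (hq : IsMinimalProjection q) :
    IsMinimalProjection (ClosedIdeal.Quot.mk (⊥ : ClosedIdeal C(OmegaPlusOne, Y)) (pointMass n q)) := by
  obtain ⟨h0, hqq, hqs, hmin⟩ := isMinimalProjection_iff.1 hq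
  rw [isMinimalProjection_mk_iff]
  simp only [ClosedIdeal.mem_bot, sub_eq_zero]
  refine ⟨fun h => h0 ?_, ?_, ?_, fun f => ?_⟩
  · rw [← pointMass_self n q, h]; rfl
  · rw [mul_pointMass, pointMass_self, hqq]
  · rw [star_pointMass, hqs]
  · obtain ⟨c, hc⟩ := hmin (f n)
    exact ⟨c, by rw [mul_pointMass, pointMass_mul, pointMass_self, hc, smul_pointMass]⟩

/-- Compressing by `q` gives values in `ker σ`, and modulo `vanishingIdeal σ` such functions are
determined by their value at `∞`. -/
theorem isMinimalProjection_mk_vanishingIdeal_const {q : Y} (hq : IsMinimalProjection q)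
    (hσ : σ q = 0) :
    IsMinimalProjection (ClosedIdeal.Quot.mk (vanishingIdeal σ) (ContinuousMap.const OmegaPlusOne q)) := by
  obtain ⟨h0, hqq, hqs, hmin⟩ := isMinimalProjection_iff.1 hq
  rw [isMinimalProjection_mk_iff]
  refine ⟨fun h => h0 h.2, ?_, ?_, fun f => ?_⟩
  · refine ⟨fun n => ?_, ?_⟩ <;> simp [hqq]
  · refine ⟨fun n => ?_, ?_⟩ <;> simp [hqs]
  · obtain ⟨c, hc⟩ := hmin (f OnePoint.infty)
    exact ⟨c, fun n => by simp [hσ], by simp [hc]⟩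

/-- At an isolated point the quotient only remembers the scalar `σ (f n)`. -/
theorem isMinimalProjection_mk_vanishingIdeal_pointMass (n : ℕ) :
    IsMinimalProjection (ClosedIdeal.Quot.mk (vanishingIdeal σ) (pointMass n 1)) := by
  rw [isMinimalProjection_mk_iff]
  refine ⟨fun h => ?_, ?_, ?_, fun f => ⟨σ (f n), ?_⟩⟩
  · have := h.1 n
    rw [pointMass_self, map_one] at this
    exact one_ne_zero this
  · rw [mul_pointMass, pointMass_self, one_mul, sub_self]
    exact (vanishingIdeal σ).toSubmodule.zero_mem
  · rw [star_pointMass, star_one, sub_self]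
    exact (vanishingIdeal σ).toSubmodule.zero_mem
  · rw [mul_pointMass, pointMass_mul, pointMass_self, smul_pointMass, ← pointMass_sub]
    exact pointMass_mem_vanishingIdeal n (by simp)

theorem isMinimalProjection_mk_limitIdeal_one :
    IsMinimalProjection (ClosedIdeal.Quot.mk (limitIdeal σ) 1) := by
  rw [isMinimalProjection_mk_iff]
  refine ⟨fun h => ?_, ?_, ?_, fun f => ⟨σ (f OnePoint.infty), ?_⟩⟩
  · rw [mem_limitIdeal, ContinuousMap.one_apply, map_one] at h
    exact one_ne_zero h
  all_goals rw [mem_limitIdeal]; simp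

theorem atomIdeal_quot_bot (hσ : IsAtomicEssentialCharacter σ) :
    atomIdeal (⊥ : ClosedIdeal C(OmegaPlusOne, Y)).Quot =
      ClosedIdeal.Quot.mk ⊥ '' (vanishingIdeal σ : Set C(OmegaPlusOne, Y)) := by
  have hle : (⊥ : ClosedIdeal C(OmegaPlusOne, Y)) ≤ vanishingIdeal σ := fun f hf => by
    rw [ClosedIdeal.mem_bot.1 hf]; exact (vanishingIdeal σ).toSubmodule.zero_mem
  refine atomIdeal_quot_eq hle (fun p hp => ?_) fun S hS _ hmin f hf => ?_
  · by_contra hpJ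
    have hann := fun k hk => mul_mul_mem_of_isMinimalProjection hle hp hpJ (k := k) hk
    obtain ⟨h0, -, hs, -⟩ := (isMinimalProjection_mk_iff _).1 hp
    rw [ClosedIdeal.mem_bot, sub_eq_zero] at hs
    -- Annihilating the point masses over `ker σ` means `p n * k * p n = 0` for all `k ∈ ker σ`, so
    -- `p n = 0` by essentiality.
    refine h0 (ClosedIdeal.mem_bot.2 (ext_omega fun n => hσ.essential _ ?_ fun k hk => ?_))
    · exact congrArg (fun g : C(OmegaPlusOne, Y) => g n) hs
    · have := ClosedIdeal.mem_bot.1 (hann _ (pointMass_mem_vanishingIdeal n hk))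
      rw [mul_pointMass, pointMass_mul] at this
      rw [← pointMass_self n (p n * k * p n), this]
      rfl
  · refine mem_of_pointMass_mem (S := S.toAddSubgroup) hS ?_ fun n => ?_
    · rw [hf.2]; exact S.zero_mem
    · rw [hf.2, sub_zero]
      refine hσ.span (S.comap (pointMassLinear n)) (hS.preimage (continuous_pointMass n)) (fun q hq _ => ?_)
        _ (hf.1 n)
      exact hmin _ (isMinimalProjection_mk_bot_pointMass n hq)

theorem atomIdeal_quot_vanishingIdeal (hσ : IsAtomicEssentialCharacter σ) :
    atomIdeal (vanishingIdeal σ).Quot =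
      ClosedIdeal.Quot.mk (vanishingIdeal σ) '' (limitIdeal σ : Set C(OmegaPlusOne, Y)) := by
  have hle : vanishingIdeal σ ≤ limitIdeal σ := fun f hf => by
    rw [mem_limitIdeal, hf.2, map_zero]
  refine atomIdeal_quot_eq hle (fun p hp => ?_) fun S hS hI hmin f hf => ?_
  · by_contra hpJ
    have hann := fun k hk => mul_mul_mem_of_isMinimalProjection hle hp hpJ (k := k) hk
    -- Annihilating `δₙ 1` modulo `vanishingIdeal σ` gives `σ (p n)² = 0`; letting `n` tend to `∞`
    -- contradicts `p ∉ limitIdeal σ`.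
    have h0 : ∀ n : ℕ, σ (p n) = 0 := fun n => by
      have := (hann _ (pointMass_mem_limitIdeal n 1)).1 n
      rw [mul_pointMass, pointMass_mul, pointMass_self, mul_one, map_mul] at this
      exact mul_self_eq_zero.1 this
    refine hpJ (tendsto_nhds_unique ((σ.continuous_character.tendsto _).comp
      (tendsto_apply_infty p)) (tendsto_const_nhds.congr fun n => (h0 n).symm))
  · refine mem_of_pointMass_mem (S := S.toAddSubgroup) hS ?_ fun n => ?_
    · refine hσ.span (S.comap constLinear) (hS.preimage ContinuousMap.continuous_const')
        (fun q hq hq0 => ?_) _ hf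
      exact hmin _ (isMinimalProjection_mk_vanishingIdeal_const hq hq0)
    · set b := f n - f OnePoint.infty
      -- The splitting `b = σ(b) 1 + k` with `k ∈ ker σ`: the first term is a multiple of a minimal
      -- projection of the quotient, the second lies in the ideal.
      have : pointMass n b = σ b • pointMass n 1 + pointMass n (b - σ b • 1) := by
        rw [smul_pointMass, ← pointMass_add, add_sub_cancel]
      rw [this]
      exact S.add_mem (S.smul_mem _ (hmin _ (isMinimalProjection_mk_vanishingIdeal_pointMass n)))
        (hI _ (pointMass_mem_vanishingIdeal n (by simp)))

/-- The quotient is one-dimensional, spanned by the class of `1`, so the sequence ends here. -/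
theorem atomIdeal_quot_limitIdeal :
    atomIdeal (limitIdeal σ).Quot =
      ClosedIdeal.Quot.mk (limitIdeal σ) '' ((⊤ : ClosedIdeal C(OmegaPlusOne, Y)) : Set C(OmegaPlusOne, Y)) := by
  refine atomIdeal_quot_eq (fun _ _ => trivial) (fun _ _ => trivial) fun S _ hI hmin f _ => ?_
  have : f = σ (f OnePoint.infty) • 1 + (f - σ (f OnePoint.infty) • 1) := by abel
  rw [this]
  refine S.add_mem (S.smul_mem _ (hmin _ isMinimalProjection_mk_limitIdeal_one)) (hI _ ?_)
  rw [mem_limitIdeal]; simp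

variable (σ) in
/-- The Cantor–Bendixson sequence of `C(ω + 1, Y)`. -/
def exampleSequence : ℕ → ClosedIdeal C(OmegaPlusOne, Y)
  | 0 => ⊥
  | 1 => vanishingIdeal σ
  | 2 => limitIdeal σ
  | _ => ⊤

theorem isCantorBendixsonSequence_exampleSequence (hσ : IsAtomicEssentialCharacter σ) :
    IsCantorBendixsonSequence C(OmegaPlusOne, Y) ((3 : ℕ) : Ordinal.{u})
      (fun α => exampleSequence σ (Cardinal.toNat α.card)) := by
  refine isCantorBendixsonSequence_of_nat 3 rfl rfl (fun m hm => ?_) (fun m hm => ?_)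
  · obtain ⟨q, hq, hq0⟩ := hσ.exists_minimal
    have key : ∀ (I J : ClosedIdeal C(OmegaPlusOne, Y)), (∀ f ∈ I, f ∈ J) →
        (∃ f ∈ J, f ∉ I) → I < J := fun I J h ⟨f, hf, hf'⟩ =>
      lt_of_le_of_ne h fun e => hf' (e ▸ hf)
    interval_cases m
    · refine key _ _ (fun f hf => ?_) ⟨pointMass 0 q, pointMass_mem_vanishingIdeal 0 hq0, fun h => ?_⟩
      · rw [ClosedIdeal.mem_bot.1 hf]; exact (vanishingIdeal σ).toSubmodule.zero_mem
      · refine hq.1 ?_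
        rw [← pointMass_self 0 q, ClosedIdeal.mem_bot.1 h]; rfl
    · refine key _ _ (fun f hf => ?_) ⟨ContinuousMap.const _ q, hq0, fun h => hq.1 h.2⟩
      change σ _ = 0
      rw [hf.2, map_zero]
    · refine key _ _ (fun f _ => trivial) ⟨1, trivial, fun h => ?_⟩
      have h1 : σ 1 = 0 := h
      rw [map_one] at h1
      exact one_ne_zero h1
  · interval_cases m
    · exact atomIdeal_quot_bot hσ
    · exact atomIdeal_quot_vanishingIdeal hσ
    · exact atomIdeal_quot_limitIdeal

end Derivatives

/-! ### Irreducible representations and the ideal `CCR` -/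

section CCR

variable {A : Type*} [NonUnitalCStarAlgebra A] {H : Type*} [NormedAddCommGroup H]
  [InnerProductSpace ℂ H]

theorem isCompactOperator_of_range_le_span {T : H →L[ℂ] H} {η : H}
    (h : ∀ x, T x ∈ Submodule.span ℂ {η}) : IsCompactOperator T :=
  (isCompactOperator_of_locallyCompactSpace_dom (T.codRestrict _ h)).clm_comp
    (Submodule.span ℂ {η}).subtypeL

variable [CompleteSpace H]

/-- An irreducible representation sends an element generating a one-dimensional corner to an
operator of rank at most one. -/
theorem IsIrreducibleRep.isCompactOperator_of_corner {π : A →⋆ₙₐ[ℂ] (H →L[ℂ] H)}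
    (hπ : IsIrreducibleRep π) {p : A} (hpp : p * p = p)
    (hcorner : ∀ a, ∃ c : ℂ, π (p * a * p) = c • π p) : IsCompactOperator (π p) := by
  by_cases h0 : ∀ ξ, π p ξ = 0
  · rw [show π p = 0 from ContinuousLinearMap.ext h0]
    exact isCompactOperator_zero
  push Not at h0
  obtain ⟨ξ, hξ⟩ := h0
  have hηη : π p (π p ξ) = π p ξ := by
    change (π p * π p) ξ = π p ξ
    rw [← map_mul, hpp]
  set η := π p ξ with hη
  let orbit : A →ₗ[ℂ] H :=
    { toFun := fun a => π a η
      map_add' := fun a b => by rw [map_add]; rfl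
      map_smul' := fun c a => by rw [map_smul]; rfl }
  let S := (LinearMap.range orbit).topologicalClosure
  have hS : S = ⊤ := by
    refine (hπ.2 S (Submodule.isClosed_topologicalClosure _) fun a x hx => ?_).resolve_left fun h => ?_
    · have h1 : Set.MapsTo (π a) (LinearMap.range orbit : Set H) (LinearMap.range orbit) := by
        rintro _ ⟨b, rfl⟩
        exact ⟨a * b, by change π (a * b) η = π a (π b η); rw [map_mul]; rfl⟩
      exact h1.closure (π a).continuous hx
    · have h1 : η ∈ S := subset_closure ⟨p, hηη⟩
      rw [h, Submodule.mem_bot] at h1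
      exact hξ h1
  -- `π p` maps `π a η` to `π (p * a * p) ξ`, a multiple of `η`. The vectors `π a η` are dense by
  -- irreducibility and the line `ℂ η` is closed.
  refine isCompactOperator_of_range_le_span (η := η) fun x => ?_
  have hx : x ∈ closure (LinearMap.range orbit : Set H) := by
    have : x ∈ S := hS ▸ Submodule.mem_top
    exact this
  have hcl : IsClosed (π p ⁻¹' (Submodule.span ℂ {η} : Set H)) :=
    (Submodule.closed_of_finiteDimensional _).preimage (π p).continuous
  refine closure_minimal ?_ hcl hx
  rintro _ ⟨a, rfl⟩
  obtain ⟨c, hc⟩ := hcorner a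
  refine Submodule.mem_span_singleton.2 ⟨c, ?_⟩
  have h2 := congrArg (fun T : H →L[ℂ] H => T ξ) hc
  rw [map_mul, map_mul] at h2
  exact h2.symm

/-- Schur's lemma for a central idempotent: the kernel of `π e` is invariant. -/
theorem IsIrreducibleRep.apply_central {π : A →⋆ₙₐ[ℂ] (H →L[ℂ] H)} (hπ : IsIrreducibleRep π)
    {e : A} (hee : e * e = e) (hcomm : ∀ a, e * a = a * e) : π e = 0 ∨ π e = 1 := by
  have hinv : ∀ a, ∀ x ∈ LinearMap.ker (π e : H →ₗ[ℂ] H), π a x ∈ LinearMap.ker (π e : H →ₗ[ℂ] H) := by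
    intro a x hx
    rw [LinearMap.mem_ker] at hx ⊢
    change (π e * π a) x = 0
    rw [← map_mul, hcomm, map_mul]
    change π a (π e x) = 0
    rw [show π e x = 0 from hx, map_zero]
  rcases hπ.2 _ (π e).isClosed_ker hinv with h | h
  · right
    ext1 x
    have h1 : π e x - x ∈ LinearMap.ker (π e : H →ₗ[ℂ] H) := by
      rw [LinearMap.mem_ker, map_sub, sub_eq_zero]
      change (π e * π e) x = π e x
      rw [← map_mul, hee]
    rw [h, Submodule.mem_bot, sub_eq_zero] at h1
    exact h1
  · left
    ext1 x
    have : x ∈ LinearMap.ker (π e : H →ₗ[ℂ] H) := h ▸ Submodule.mem_top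
    exact this

variable {Y : Type u} [CStarAlgebra Y]

/-- The corner `p A p` is approximated by combinations of `p` and `(δₙ 1) p`. The `δₙ 1` are central
idempotents, so an irreducible `π` sends each to `0` or `1` and the corner into `ℂ π(p)`. No list of
the irreducible representations is needed. -/
theorem const_mem_ccrIdeal {q : Y} (hq : IsMinimalProjection q) :
    ContinuousMap.const OmegaPlusOne q ∈ ccrIdeal C(OmegaPlusOne, Y) := by
  obtain ⟨-, hqq, -, hmin⟩ := isMinimalProjection_iff.1 hq
  intro H _ _ _ π hπ
  set p : C(OmegaPlusOne, Y) := ContinuousMap.const OmegaPlusOne q with hp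
  have hpp : p * p = p := by ext x; exact hqq
  refine hπ.isCompactOperator_of_corner hpp fun f => ?_
  let T : Submodule ℂ (H →L[ℂ] H) := Submodule.span ℂ {π p}
  let S : AddSubgroup C(OmegaPlusOne, Y) :=
    T.toAddSubgroup.comap (π : C(OmegaPlusOne, Y) →+ (H →L[ℂ] H))
  have hS : IsClosed (S : Set C(OmegaPlusOne, Y)) :=
    (Submodule.closed_of_finiteDimensional T).preimage π.continuous_of_cstar
  have hSmem : ∀ g, g ∈ S ↔ π g ∈ Submodule.span ℂ {π p} := fun g => Iff.rfl
  choose c hc using fun x : OmegaPlusOne => hmin (f x)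
  have hval : ∀ x, (p * f * p) x = c x • q := hc
  suffices h : p * f * p ∈ S by
    obtain ⟨d, hd⟩ := Submodule.mem_span_singleton.1 ((hSmem _).1 h)
    exact ⟨d, hd.symm⟩
  refine mem_of_pointMass_mem hS ?_ fun n => ?_
  · rw [hval, hSmem]
    have : ContinuousMap.const OmegaPlusOne (c OnePoint.infty • q) = c OnePoint.infty • p := rfl
    rw [this, map_smul]
    exact Submodule.smul_mem _ _ (Submodule.mem_span_singleton_self _)
  · rw [hval, hval, ← sub_smul, ← smul_pointMass, hSmem, map_smul]
    refine Submodule.smul_mem _ _ ?_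
    have h1 : pointMass n q = pointMass n 1 * p := by
      rw [pointMass_mul, one_mul]; rfl
    rw [h1, map_mul]
    rcases hπ.apply_central (e := pointMass n 1) (by rw [mul_pointMass, pointMass_self, one_mul])
      (fun g => by rw [mul_pointMass, pointMass_mul, one_mul, mul_one]) with h | h
    · rw [h, zero_mul]; exact Submodule.zero_mem _
    · rw [h, one_mul]; exact Submodule.mem_span_singleton_self _

/-- Evaluation at `n` is surjective, so composing it with an irreducible representation of `Y` keeps
irreducibility. -/
theorem pointMass_notMem_ccrIdeal {H : Type u} [NormedAddCommGroup H] [InnerProductSpace ℂ H]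
    [CompleteSpace H] {ρ : Y →⋆ₙₐ[ℂ] (H →L[ℂ] H)} (hρ : IsIrreducibleRep ρ) {b : Y}
    (hb : ¬ IsCompactOperator (ρ b)) (n : ℕ) :
    pointMass n b ∉ ccrIdeal C(OmegaPlusOne, Y) := by
  intro h
  have hirr : IsIrreducibleRep (ρ.comp (evalHom (n : OmegaPlusOne))) := by
    refine ⟨fun h0 => hρ.1 ?_, fun S hS hinv => hρ.2 S hS fun a x hx => ?_⟩
    · ext1 a
      have := DFunLike.congr_fun h0 (pointMass n a)
      rwa [NonUnitalStarAlgHom.comp_apply, evalHom_apply, pointMass_self] at this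
    · have := hinv (pointMass n a) x hx
      rwa [NonUnitalStarAlgHom.comp_apply, evalHom_apply, pointMass_self] at this
  have := h H _ hirr
  rw [NonUnitalStarAlgHom.comp_apply, evalHom_apply, pointMass_self] at this
  exact hb this

theorem exampleSequence_ne_ccrIdeal {σ : Y →⋆ₐ[ℂ] ℂ} (hσ : IsAtomicEssentialCharacter σ)
    {H : Type u} [NormedAddCommGroup H] [InnerProductSpace ℂ H]
    [CompleteSpace H] {ρ : Y →⋆ₙₐ[ℂ] (H →L[ℂ] H)} (hρ : IsIrreducibleRep ρ)
    (hρ1 : ¬ IsCompactOperator (ρ 1)) (n : ℕ) :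
    exampleSequence σ n ≠ ccrIdeal C(OmegaPlusOne, Y) := by
  obtain ⟨q, hq, -⟩ := hσ.exists_minimal
  have h1 := const_mem_ccrIdeal hq
  have h2 := pointMass_notMem_ccrIdeal hρ hρ1 0
  intro h
  rw [← h] at h1 h2
  match n with
  | 0 => exact hq.1 (congrArg (fun g : C(OmegaPlusOne, Y) => g OnePoint.infty)
      (ClosedIdeal.mem_bot.1 h1))
  | 1 => exact hq.1 h1.2
  | 2 => exact h2 (pointMass_mem_limitIdeal 0 1)
  | _ + 3 => exact h2 trivial

end CCR

/-! ### Uniqueness of the C*-tensor product -/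

section TensorProduct

open scoped TensorProduct

variable {Y : Type*} [CStarAlgebra Y]

/-- The embedding `f ↦ f(·)1`. -/
def scalarEmbedding : C(OmegaPlusOne, ℂ) →⋆ₐ[ℂ] C(OmegaPlusOne, Y) where
  toFun f := ⟨fun x => algebraMap ℂ Y (f x), (continuous_algebraMap ℂ Y).comp f.continuous⟩
  map_one' := by ext x; simp
  map_mul' f g := by ext x; simp
  map_zero' := by ext x; simp
  map_add' f g := by ext x; simp
  commutes' c := by ext x; rfl
  map_star' f := by ext x; exact algebraMap_star_comm (f x)

theorem scalarEmbedding_apply (f : C(OmegaPlusOne, ℂ)) (x : OmegaPlusOne) :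
    (scalarEmbedding f : C(OmegaPlusOne, Y)) x = algebraMap ℂ Y (f x) := rfl

/-- The embedding of `Y` as constant functions. -/
def constEmbedding : Y →⋆ₐ[ℂ] C(OmegaPlusOne, Y) where
  toFun b := ContinuousMap.const _ b
  map_one' := rfl
  map_mul' _ _ := rfl
  map_zero' := rfl
  map_add' _ _ := rfl
  commutes' _ := rfl
  map_star' _ := rfl

theorem constEmbedding_apply (b : Y) (x : OmegaPlusOne) : constEmbedding b x = b := rfl

theorem commute_embeddings (f : C(OmegaPlusOne, ℂ)) (b : Y) :
    Commute (scalarEmbedding f) (constEmbedding b) := by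
  ext x
  exact Algebra.commutes (f x) b

/-- The homomorphism `a ⊗ b ↦ i a * j b` for `i` and `j` with commuting images. -/
def tensorLift {A B T : Type*} [CStarAlgebra A] [CStarAlgebra B] [CStarAlgebra T]
    (i : A →⋆ₐ[ℂ] T) (j : B →⋆ₐ[ℂ] T) (h : ∀ a b, Commute (i a) (j b)) : A ⊗[ℂ] B →ₐ[ℂ] T :=
  Algebra.TensorProduct.lift (i : A →ₐ[ℂ] T) (j : B →ₐ[ℂ] T) h

theorem tensorLift_tmul {A B T : Type*} [CStarAlgebra A] [CStarAlgebra B] [CStarAlgebra T]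
    (i : A →⋆ₐ[ℂ] T) (j : B →⋆ₐ[ℂ] T) (h : ∀ a b, Commute (i a) (j b)) (a : A) (b : B) :
    tensorLift i j h (a ⊗ₜ b) = i a * j b :=
  Algebra.TensorProduct.lift_tmul ..

variable (Y) in
/-- The canonical map `C(ω + 1) ⊗ Y → C(ω + 1, Y)`. -/
def tensorEmbedding : C(OmegaPlusOne, ℂ) ⊗[ℂ] Y →ₐ[ℂ] C(OmegaPlusOne, Y) :=
  tensorLift scalarEmbedding constEmbedding commute_embeddings

theorem tensorEmbedding_tmul (f : C(OmegaPlusOne, ℂ)) (b : Y) :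
    tensorEmbedding Y (f ⊗ₜ b) = scalarEmbedding f * constEmbedding b :=
  tensorLift_tmul ..

theorem tensorEmbedding_one : tensorEmbedding Y 1 = 1 := (tensorEmbedding Y).map_one'

theorem tensorEmbedding_tmul_apply (f : C(OmegaPlusOne, ℂ)) (b : Y) (x : OmegaPlusOne) :
    tensorEmbedding Y (f ⊗ₜ b) x = f x • b := by
  rw [tensorEmbedding_tmul, ContinuousMap.mul_apply, scalarEmbedding_apply, constEmbedding_apply,
    ← Algebra.smul_def]

/-- Expand a tensor over a basis of `Y`, with functions as coefficients. At each point, linear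
independence of the basis makes all coefficients vanish. -/
theorem tensorEmbedding_injective : Function.Injective (tensorEmbedding Y) := by
  rw [injective_iff_map_eq_zero]
  intro t ht
  obtain ⟨c, rfl⟩ := TensorProduct.eq_repr_basis_right (Module.Basis.ofVectorSpace ℂ Y) t
  set B := Module.Basis.ofVectorSpace ℂ Y
  have hc : c = 0 := by
    ext i x
    have h1 := congrArg (fun g : C(OmegaPlusOne, Y) => g x) ht
    simp only [Finsupp.sum, map_sum, ContinuousMap.sum_apply, tensorEmbedding_tmul_apply,
      ContinuousMap.zero_apply] at h1
    by_cases hi : i ∈ c.support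
    · exact linearIndependent_iff'.1 B.linearIndependent c.support (fun i => c i x) h1 i hi
    · rw [Finsupp.notMem_support_iff.1 hi]; rfl
  rw [hc, Finsupp.sum_zero_index]

/-- The element of the algebraic tensor product corresponding to `truncate N f`. -/
def truncateTensor (N : ℕ) (f : C(OmegaPlusOne, Y)) : C(OmegaPlusOne, ℂ) ⊗[ℂ] Y :=
  1 ⊗ₜ f OnePoint.infty + ∑ n ∈ Finset.range N, pointMass n 1 ⊗ₜ (f n - f OnePoint.infty)

theorem tensorEmbedding_pointMass_tmul (n : ℕ) (b : Y) :
    tensorEmbedding Y (pointMass n 1 ⊗ₜ b) = pointMass n b := by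
  refine ext_omega fun m => ?_
  rw [tensorEmbedding_tmul_apply, pointMass_apply, pointMass_apply]
  split_ifs <;> simp

theorem tensorEmbedding_truncateTensor (N : ℕ) (f : C(OmegaPlusOne, Y)) :
    tensorEmbedding Y (truncateTensor N f) = truncate N f := by
  rw [truncateTensor, truncate, map_add, map_sum]
  simp only [tensorEmbedding_pointMass_tmul]
  congr 1
  ext x
  rw [tensorEmbedding_tmul_apply]
  simp

theorem denseRange_tensorEmbedding : DenseRange (tensorEmbedding Y) := fun f =>
  mem_closure_of_tendsto (tendsto_truncate f)
    (Eventually.of_forall fun N => ⟨truncateTensor N f, tensorEmbedding_truncateTensor N f⟩)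

theorem isCStarTensorProduct_continuousMap :
    IsCStarTensorProduct (A := C(OmegaPlusOne, ℂ)) (B := Y) (T := C(OmegaPlusOne, Y))
      scalarEmbedding constEmbedding where
  commute := fun f b => commute_embeddings (Y := Y) f b
  injective := tensorEmbedding_injective (Y := Y)
  dense := denseRange_tensorEmbedding (Y := Y)

theorem truncate_truncate {N M : ℕ} (hNM : N ≤ M) (f : C(OmegaPlusOne, Y)) :
    truncate M (truncate N f) = truncate N f := by
  refine ext_omega fun n => ?_
  rw [truncate_apply, truncate_apply, truncate_infty]
  split_ifs <;> first | rfl | omega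

theorem truncate_mul (N : ℕ) (f g : C(OmegaPlusOne, Y)) :
    truncate N (f * g) = truncate N f * truncate N g := by
  refine ext_omega fun n => ?_
  rw [ContinuousMap.mul_apply]
  simp only [truncate_apply]
  split_ifs <;> rfl

theorem truncate_add (N : ℕ) (f g : C(OmegaPlusOne, Y)) :
    truncate N (f + g) = truncate N f + truncate N g := by
  refine ext_omega fun n => ?_
  rw [ContinuousMap.add_apply]
  simp only [truncate_apply]
  split_ifs <;> rfl

theorem truncate_smul (N : ℕ) (c : ℂ) (f : C(OmegaPlusOne, Y)) :
    truncate N (c • f) = c • truncate N f := by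
  refine ext_omega fun n => ?_
  rw [ContinuousMap.smul_apply]
  simp only [truncate_apply]
  split_ifs <;> rfl

theorem truncate_one (N : ℕ) : truncate N (1 : C(OmegaPlusOne, Y)) = 1 := by
  refine ext_omega fun n => ?_
  rw [truncate_apply]
  split_ifs <;> rfl

/-- `f ↦ truncateTensor N f` as a homomorphism of algebras. -/
def truncateTensorHom (N : ℕ) : C(OmegaPlusOne, Y) →ₐ[ℂ] C(OmegaPlusOne, ℂ) ⊗[ℂ] Y :=
  AlgHom.ofLinearMap
    { toFun := truncateTensor N
      map_add' := fun f g => tensorEmbedding_injective (by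
        simp only [map_add, tensorEmbedding_truncateTensor, truncate_add])
      map_smul' := fun c f => tensorEmbedding_injective (by
        simp only [map_smul, tensorEmbedding_truncateTensor, truncate_smul, RingHom.id_apply]) }
    (tensorEmbedding_injective ((tensorEmbedding_truncateTensor N 1).trans
      ((truncate_one N).trans tensorEmbedding_one.symm)))
    (fun f g => tensorEmbedding_injective (by
      rw [map_mul (tensorEmbedding Y)]
      change tensorEmbedding Y (truncateTensor N (f * g)) =
        tensorEmbedding Y (truncateTensor N f) * tensorEmbedding Y (truncateTensor N g)
      simp only [tensorEmbedding_truncateTensor, truncate_mul]))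

theorem truncateTensor_embedding (N : ℕ) (f : C(OmegaPlusOne, ℂ)) (b : Y) :
    truncateTensor N (scalarEmbedding f * constEmbedding b) = truncate N f ⊗ₜ b := by
  apply tensorEmbedding_injective
  rw [tensorEmbedding_truncateTensor]
  refine ext_omega fun n => ?_
  rw [tensorEmbedding_tmul_apply, truncate_apply, truncate_apply, ContinuousMap.mul_apply,
    ContinuousMap.mul_apply, scalarEmbedding_apply, scalarEmbedding_apply, constEmbedding_apply,
    constEmbedding_apply, ← Algebra.smul_def, ← Algebra.smul_def]
  split_ifs <;> rfl

namespace IsCStarTensorProduct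

variable {T : Type*} [CStarAlgebra T] {i : C(OmegaPlusOne, ℂ) →⋆ₐ[ℂ] T} {j : Y →⋆ₐ[ℂ] T}
  (h : IsCStarTensorProduct (A := C(OmegaPlusOne, ℂ)) (B := Y) (T := T) i j)

/-- The canonical map from the algebraic tensor product to a `C*`-tensor product. -/
def lift : C(OmegaPlusOne, ℂ) ⊗[ℂ] Y →ₐ[ℂ] T :=
  tensorLift i j h.commute

theorem lift_tmul (f : C(OmegaPlusOne, ℂ)) (b : Y) : h.lift (f ⊗ₜ b) = i f * j b :=
  tensorLift_tmul ..

/-- The `*`-homomorphism `f ↦ lift (truncateTensor N f)`. -/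
def approx (N : ℕ) : C(OmegaPlusOne, Y) →⋆ₐ[ℂ] T :=
  { h.lift.comp (truncateTensorHom N) with
    map_star' := fun f => by
      have hstar : ∀ n : ℕ, star (i (pointMass n 1)) = i (pointMass n 1) := fun n => by
        rw [← map_star, star_pointMass, star_one]
      change h.lift (truncateTensor N (star f)) = star (h.lift (truncateTensor N f))
      simp only [truncateTensor, map_add, map_sum, lift_tmul, star_add, star_sum, star_mul, hstar,
        map_one, one_mul, ← map_star, star_sub, ContinuousMap.star_apply]
      congr 1
      -- The involution reverses the two factors of each term, and the images of `i` and `j`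
      -- commute.
      exact Finset.sum_congr rfl fun n _ => h.commute _ _ }

theorem approx_apply (N : ℕ) (f : C(OmegaPlusOne, Y)) :
    h.approx N f = h.lift (truncateTensor N f) := rfl

theorem approx_truncate {N M : ℕ} (hNM : N ≤ M) (f : C(OmegaPlusOne, Y)) :
    h.approx M (truncate N f) = h.approx N f := by
  rw [approx_apply, approx_apply]
  congr 1
  apply tensorEmbedding_injective
  rw [tensorEmbedding_truncateTensor, tensorEmbedding_truncateTensor, truncate_truncate hNM]

/-- `*`-homomorphisms of C*-algebras are contractive, so for `M ≥ N` the approximants of `f` differ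
by at most `‖f - truncate N f‖`, whatever the norm on `T`. -/
theorem exists_tendsto_approx (f : C(OmegaPlusOne, Y)) :
    ∃ t, Tendsto (fun N => h.approx N f) atTop (𝓝 t) := by
  refine cauchySeq_tendsto_of_complete (Metric.cauchySeq_iff'.2 fun ε hε => ?_)
  obtain ⟨N, hN⟩ := Metric.tendsto_atTop.1 (tendsto_truncate f) ε hε
  refine ⟨N, fun M hM => ?_⟩
  rw [← h.approx_truncate hM f, dist_eq_norm, ← map_sub]
  refine (NonUnitalStarAlgHom.norm_apply_le (h.approx M) _).trans_lt ?_
  rw [← dist_eq_norm, dist_comm]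
  exact hN N le_rfl

/-- The limit of the `*`-homomorphisms `approx N`. -/
def limitHom : C(OmegaPlusOne, Y) →⋆ₐ[ℂ] T :=
  let t := fun f => (h.exists_tendsto_approx f).choose
  have ht : ∀ f, Tendsto (fun N => h.approx N f) atTop (𝓝 (t f)) :=
    fun f => (h.exists_tendsto_approx f).choose_spec
  { toFun := t
    map_one' := tendsto_nhds_unique (ht 1) (by simp only [map_one]; exact tendsto_const_nhds)
    map_mul' := fun f g => tendsto_nhds_unique (ht _) (by
      simp only [map_mul]; exact (ht f).mul (ht g))
    map_zero' := tendsto_nhds_unique (ht 0) (by simp only [map_zero]; exact tendsto_const_nhds)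
    map_add' := fun f g => tendsto_nhds_unique (ht _) (by
      simp only [map_add]; exact (ht f).add (ht g))
    commutes' := fun c => tendsto_nhds_unique (ht _) (by
      simp only [AlgHomClass.commutes]; exact tendsto_const_nhds)
    map_star' := fun f => tendsto_nhds_unique (ht _) (by
      simp only [map_star]; exact (ht f).star) }

theorem tendsto_approx (f : C(OmegaPlusOne, Y)) :
    Tendsto (fun N => h.approx N f) atTop (𝓝 (h.limitHom f)) :=
  (h.exists_tendsto_approx f).choose_spec

theorem limitHom_mul (f : C(OmegaPlusOne, ℂ)) (b : Y) :
    h.limitHom (scalarEmbedding f * constEmbedding b) = i f * j b := by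
  refine tendsto_nhds_unique (h.tendsto_approx _) ?_
  simp only [approx_apply, truncateTensor_embedding, lift_tmul]
  have hi : Continuous i :=
    NonUnitalStarAlgHom.continuous_of_cstar (i : C(OmegaPlusOne, ℂ) →⋆ₙₐ[ℂ] T)
  exact ((hi.tendsto _).comp (tendsto_truncate f)).mul_const _

theorem limitHom_scalarEmbedding (f : C(OmegaPlusOne, ℂ)) :
    h.limitHom (scalarEmbedding f) = i f := by
  simpa using h.limitHom_mul f 1

theorem limitHom_constEmbedding (b : Y) : h.limitHom (constEmbedding b) = j b := by
  simpa using h.limitHom_mul 1 b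

theorem limitHom_tensorEmbedding (t : C(OmegaPlusOne, ℂ) ⊗[ℂ] Y) :
    h.limitHom (tensorEmbedding Y t) = h.lift t := by
  induction t with
  | zero => simp only [map_zero]
  | tmul f b => rw [tensorEmbedding_tmul, limitHom_mul, lift_tmul]
  | add s t hs ht => simp only [map_add, hs, ht]

/-- If `f` is in the kernel, so is `(δₙ 1) f`, the image of the elementary tensor `δₙ 1 ⊗ f n`.
Injectivity on the algebraic tensor product then gives `f n = 0`. -/
theorem limitHom_injective : Function.Injective h.limitHom := by
  rw [injective_iff_map_eq_zero]
  intro f hf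
  refine ext_omega fun n => ?_
  have h1 : pointMass n (1 : Y) * f = tensorEmbedding Y (pointMass n 1 ⊗ₜ f n) := by
    rw [tensorEmbedding_pointMass_tmul, pointMass_mul, one_mul]
  have h2 : h.lift (pointMass n 1 ⊗ₜ f n) = 0 := by
    rw [← limitHom_tensorEmbedding, ← h1, map_mul, hf, mul_zero]
  have h3 : (pointMass n 1 ⊗ₜ f n : C(OmegaPlusOne, ℂ) ⊗[ℂ] Y) = 0 :=
    h.injective (h2.trans (map_zero _).symm)
  rw [← pointMass_self n (f n), ← tensorEmbedding_pointMass_tmul, h3, map_zero]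

theorem limitHom_surjective : Function.Surjective h.limitHom := by
  have hiso : Isometry h.limitHom := NonUnitalStarAlgHom.isometry h.limitHom h.limitHom_injective
  have hcl : IsClosed (Set.range h.limitHom) := hiso.isClosedEmbedding.isClosed_range
  intro t
  have hsub : Set.range h.lift ⊆ Set.range h.limitHom := by
    rintro _ ⟨s, rfl⟩
    exact ⟨_, h.limitHom_tensorEmbedding s⟩
  exact closure_minimal hsub hcl (h.dense t)

include h in
/-- Every `C*`-tensor product of `C(ω + 1)` and `Y` is isomorphic to `C(ω + 1, Y)`. -/
theorem exists_equiv : ∃ e : T ≃⋆ₐ[ℂ] C(OmegaPlusOne, Y),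
    (∀ f, e (i f) = scalarEmbedding f) ∧ ∀ b, e (j b) = constEmbedding b := by
  let e := (StarAlgEquiv.ofBijective h.limitHom ⟨h.limitHom_injective, h.limitHom_surjective⟩).symm
  refine ⟨e, fun f => ?_, fun b => ?_⟩
  · rw [← h.limitHom_scalarEmbedding]
    exact StarAlgEquiv.symm_apply_apply (StarAlgEquiv.ofBijective h.limitHom _) _
  · rw [← h.limitHom_constEmbedding]
    exact StarAlgEquiv.symm_apply_apply (StarAlgEquiv.ofBijective h.limitHom _) _

end IsCStarTensorProduct

end TensorProduct

/-! ### The unitization of the compact operators -/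

section UnitizedCompacts

/-- The character of the unitization of `K(ℓ₂)` with kernel `K(ℓ₂)`. -/
def scalarPart : UnitizedCompacts →⋆ₐ[ℂ] ℂ := Unitization.starLift 0

theorem scalarPart_apply (u : UnitizedCompacts) : scalarPart u = u.fst := by
  change algebraMap ℂ ℂ u.fst + 0 = u.fst
  simp

/-- The representation of the unitization of `K(ℓ₂)` on `ℓ₂`. -/
def ellTwoRep : UnitizedCompacts →⋆ₐ[ℂ] (EllTwo →L[ℂ] EllTwo) :=
  Unitization.starLift (NonUnitalStarSubalgebraClass.subtype (compactOperators EllTwo))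

theorem ellTwoRep_apply (u : UnitizedCompacts) :
    ellTwoRep u = u.fst • (1 : EllTwo →L[ℂ] EllTwo) + (u.snd : EllTwo →L[ℂ] EllTwo) := by
  rw [← Algebra.algebraMap_eq_smul_one]
  rfl

theorem ellTwoRep_inr (k : compactOperators EllTwo) :
    ellTwoRep (k : UnitizedCompacts) = (k : EllTwo →L[ℂ] EllTwo) := by
  rw [ellTwoRep_apply]; simp

theorem scalarPart_inr (k : compactOperators EllTwo) : scalarPart (k : UnitizedCompacts) = 0 := by
  rw [scalarPart_apply]; rfl

theorem exists_eq_inr_of_scalarPart_eq_zero {u : UnitizedCompacts} (h : scalarPart u = 0) :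
    ∃ k : compactOperators EllTwo, u = k := by
  rw [scalarPart_apply] at h
  exact ⟨u.snd, Unitization.ext h rfl⟩

theorem not_finiteDimensional_ellTwo : ¬ FiniteDimensional ℂ EllTwo := by
  intro h
  let b : HilbertBasis ℕ ℂ EllTwo := .ofRepr (.refl ℂ EllTwo)
  have := b.orthonormal.linearIndependent.finite
  exact not_finite ℕ

theorem not_isCompactOperator_one : ¬ IsCompactOperator (1 : EllTwo →L[ℂ] EllTwo) := fun h =>
  not_finiteDimensional_ellTwo (FiniteDimensional.of_isCompactOperator_id (𝕜 := ℂ) h)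

/-- A relation `λ 1 + k = 0` with `λ ≠ 0` would make the identity of `ℓ₂` compact. Identities in the
unitization can therefore be checked on operators. -/
theorem ellTwoRep_injective : Function.Injective ellTwoRep := by
  rw [injective_iff_map_eq_zero]
  intro u hu
  rw [ellTwoRep_apply] at hu
  have h0 : u.fst = 0 := by
    by_contra h
    refine not_isCompactOperator_one ?_
    have h1 : (1 : EllTwo →L[ℂ] EllTwo) = -(u.fst)⁻¹ • (u.snd : EllTwo →L[ℂ] EllTwo) := by
      rw [← neg_eq_of_add_eq_zero_right hu, smul_neg, neg_smul, neg_neg, smul_smul,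
        inv_mul_cancel₀ h, one_smul]
    rw [h1]
    exact (compactOperators EllTwo).smul_mem _ u.snd.2
  rw [h0, zero_smul, zero_add] at hu
  exact Unitization.ext h0 (Subtype.ext hu)

theorem HasAtom.of_unitizedCompacts {B : NonUnitalStarSubalgebra ℂ UnitizedCompacts}
    (hB : IsClosed (B : Set UnitizedCompacts)) (hne : ∃ b ∈ B, b ≠ 0) : HasAtom B := by
  refine .of_hom hB hne (scalarPart : UnitizedCompacts →⋆ₙₐ[ℂ] ℂ) (fun _ h => .of_complex h)
    fun hB' hne' => ?_
  refine .of_hom hB' hne' (ellTwoRep : UnitizedCompacts →⋆ₙₐ[ℂ] (EllTwo →L[ℂ] EllTwo))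
    (fun hc h => .of_le_compactOperators hc ?_ h) fun _ h => ?_
  · rintro _ ⟨b, hb, rfl⟩
    obtain ⟨k, rfl⟩ := exists_eq_inr_of_scalarPart_eq_zero (mem_kerSubalgebra.1 hb.2)
    exact (ellTwoRep_inr k).symm ▸ k.2
  · obtain ⟨b, hb, hb0⟩ := h
    exact absurd (ellTwoRep_injective ((mem_kerSubalgebra.1 hb.2).trans (map_zero _).symm)) hb0

end UnitizedCompacts

theorem isScattered_exampleAlgebra : IsScattered ExampleAlgebra :=
  isScattered_of_hasAtom fun _ hB hne =>
    HasAtom.of_continuousMap (fun _ hc h => .of_unitizedCompacts hc h) hB hne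

/-! ### Rank one projections, essentiality and irreducibility on `ℓ₂` -/

section EllTwo

theorem isMinimalProjection_rankOneCompact {x : EllTwo} (hx : ‖x‖ = 1) :
    IsMinimalProjection ((rankOneCompact x x : compactOperators EllTwo) : UnitizedCompacts) := by
  have hp := isStarProjection_rankOne_self (𝕜 := ℂ) hx
  have hval : ellTwoRep ((rankOneCompact x x : compactOperators EllTwo) : UnitizedCompacts) =
      rankOne ℂ x x := ellTwoRep_inr _
  rw [isMinimalProjection_iff]
  refine ⟨fun h => ?_, ?_, ?_, fun a => ⟨inner ℂ x (ellTwoRep a x), ?_⟩⟩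
  · rw [h, map_zero] at hval
    have hx0 : x ≠ 0 := fun h => by rw [h, norm_zero] at hx; exact zero_ne_one hx
    exact rankOne_ne_zero hx0 hx0 hval.symm
  · apply ellTwoRep_injective
    rw [map_mul, hval]
    exact hp.isIdempotentElem
  · apply ellTwoRep_injective
    rw [map_star, hval]
    exact hp.isSelfAdjoint
  · apply ellTwoRep_injective
    rw [map_mul, map_mul, map_smul, hval]
    ext1 z
    change rankOne ℂ x x (ellTwoRep a (rankOne ℂ x x z)) = inner ℂ x (ellTwoRep a x) • rankOne ℂ x x z
    simp only [rankOne_apply, map_smul, smul_smul]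
    rw [mul_comm]

theorem mem_of_isMinimalProjection_mem {S : Submodule ℂ UnitizedCompacts}
    (hS : IsClosed (S : Set UnitizedCompacts))
    (h : ∀ q, IsMinimalProjection q → scalarPart q = 0 → q ∈ S) {u : UnitizedCompacts}
    (hu : scalarPart u = 0) : u ∈ S := by
  obtain ⟨k, rfl⟩ := exists_eq_inr_of_scalarPart_eq_zero hu
  let S' : Submodule ℂ (compactOperators EllTwo) := S.comap (Unitization.inrHom ℂ ℂ _)
  have hS' : IsClosed (S' : Set (compactOperators EllTwo)) :=
    hS.preimage (Unitization.isometry_inr (𝕜 := ℂ)).continuous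
  exact mem_of_rankOneCompact_mem hS'
    (fun x hx => h _ (isMinimalProjection_rankOneCompact hx) (scalarPart_inr _)) k

/-- Testing with `k = |T w⟩⟨T w|` yields `‖T w‖² T² w = 0`; if `T² w = 0`, then `‖T w‖² = ⟪w, T² w⟫
= 0` as well. -/
theorem eq_zero_of_compact_corner_eq_zero {a : UnitizedCompacts} (ha : IsSelfAdjoint a)
    (h : ∀ k, scalarPart k = 0 → a * k * a = 0) : a = 0 := by
  apply ellTwoRep_injective
  rw [map_zero]
  set T := ellTwoRep a with hT
  have hTs : IsSelfAdjoint T := ha.map ellTwoRep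
  ext1 w
  have h1 : T * rankOne ℂ (T w) (T w) * T = 0 := by
    have h2 := h (rankOneCompact (T w) (T w) : compactOperators EllTwo) (scalarPart_inr _)
    have h3 := congrArg ellTwoRep h2
    rw [map_mul, map_mul, map_zero, ellTwoRep_inr] at h3
    exact h3
  have h2 : inner ℂ (T w) (T w) • T (T w) = 0 := by
    have h3 : T (rankOne ℂ (T w) (T w) (T w)) = 0 := congrArg (fun R : EllTwo →L[ℂ] EllTwo => R w) h1
    rwa [rankOne_apply, map_smul] at h3
  rcases smul_eq_zero.1 h2 with h3 | h3
  · exact inner_self_eq_zero.1 h3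
  · have h4 : inner ℂ (T w) (T w) = inner ℂ w (T (T w)) := hTs.isSymmetric w (T w)
    rw [h3, inner_zero_right] at h4
    exact inner_self_eq_zero.1 h4

theorem exists_norm_eq_one_ellTwo : ∃ x : EllTwo, ‖x‖ = 1 := by
  let b : HilbertBasis ℕ ℂ EllTwo := .ofRepr (.refl ℂ EllTwo)
  exact ⟨b 0, b.orthonormal.1 0⟩

theorem isAtomicEssentialCharacter_scalarPart : IsAtomicEssentialCharacter scalarPart where
  essential _ ha h := eq_zero_of_compact_corner_eq_zero ha h
  span _ hS h _ hk := mem_of_isMinimalProjection_mem hS h hk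
  exists_minimal :=
    let ⟨_, hx⟩ := exists_norm_eq_one_ellTwo
    ⟨_, isMinimalProjection_rankOneCompact hx, scalarPart_inr _⟩

/-- A nonzero vector `z` is carried to a nonzero multiple of any `y ≠ 0` by the compact operator
`|y⟩⟨z|`. -/
theorem isIrreducibleRep_ellTwoRep :
    IsIrreducibleRep (ellTwoRep : UnitizedCompacts →⋆ₙₐ[ℂ] (EllTwo →L[ℂ] EllTwo)) := by
  obtain ⟨x, hx⟩ := exists_norm_eq_one_ellTwo
  have hx0 : x ≠ 0 := fun h => by rw [h, norm_zero] at hx; exact zero_ne_one hx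
  refine ⟨fun h => hx0 ?_, fun S _ hinv => ?_⟩
  · have h1 : ellTwoRep 1 = 0 := DFunLike.congr_fun h 1
    rw [map_one] at h1
    exact congrArg (fun R : EllTwo →L[ℂ] EllTwo => R x) h1
  · by_cases hS : S = ⊥
    · exact .inl hS
    refine .inr (Submodule.eq_top_iff'.2 fun y => ?_)
    obtain ⟨z, hz, hz0⟩ := Submodule.exists_mem_ne_zero_of_ne_bot hS
    have h1 : ellTwoRep ((rankOneCompact y z : compactOperators EllTwo) : UnitizedCompacts) z ∈ S :=
      hinv _ z hz
    rw [ellTwoRep_inr] at h1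
    have h2 : inner ℂ z z • y ∈ S := h1
    have h3 := S.smul_mem (inner ℂ z z)⁻¹ h2
    rwa [smul_smul, inv_mul_cancel₀ (inner_self_ne_zero.2 hz0), one_smul] at h3

theorem not_isCompactOperator_ellTwoRep_one : ¬ IsCompactOperator (ellTwoRep 1) := by
  rw [map_one]
  exact not_isCompactOperator_one

end EllTwo

end

theorem mainTheorem11 :
    -- `C(ω + 1, K(ℓ₂)~)` is the C*-tensor product `C(ω + 1) ⊗ K(ℓ₂)~`
    (∃ (i : C(OmegaPlusOne, ℂ) →⋆ₐ[ℂ] ExampleAlgebra) (j : UnitizedCompacts →⋆ₐ[ℂ] ExampleAlgebra),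
      (∀ f x, i f x = algebraMap ℂ UnitizedCompacts (f x)) ∧ (∀ b x, j b x = b) ∧
      IsCStarTensorProduct (A := C(OmegaPlusOne, ℂ)) (B := UnitizedCompacts) (T := ExampleAlgebra) i j ∧
      ∀ (T : Type) [CStarAlgebra T] (i' : C(OmegaPlusOne, ℂ) →⋆ₐ[ℂ] T)
        (j' : UnitizedCompacts →⋆ₐ[ℂ] T), IsCStarTensorProduct (A := C(OmegaPlusOne, ℂ)) (B := UnitizedCompacts) (T := T) i' j' →
        ∃ e : T ≃⋆ₐ[ℂ] ExampleAlgebra, (∀ f, e (i' f) = i f) ∧ ∀ b, e (j' b) = j b) ∧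
    -- it is scattered
    IsScattered ExampleAlgebra ∧
    -- it has a Cantor–Bendixson sequence, of height 3
    (∃ I : Ordinal.{0} → ClosedIdeal ExampleAlgebra,
      IsCantorBendixsonSequence ExampleAlgebra 3 I) ∧
    -- in the Cantor–Bendixson sequence, whose height is 3, the ideal `CCR` does not appear
    ∀ (θ : Ordinal.{0}) (I : Ordinal.{0} → ClosedIdeal ExampleAlgebra),
      IsCantorBendixsonSequence ExampleAlgebra θ I →
        θ = 3 ∧ ∀ α ≤ θ, I α ≠ ccrIdeal ExampleAlgebra := by
  have h3 : ((3 : ℕ) : Ordinal.{0}) = 3 := Nat.cast_ofNat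
  have hseq := isCantorBendixsonSequence_exampleSequence isAtomicEssentialCharacter_scalarPart
  refine ⟨⟨scalarEmbedding, constEmbedding, fun _ _ => rfl, fun _ _ => rfl,
    isCStarTensorProduct_continuousMap, fun T _ i' j' h => h.exists_equiv⟩,
    isScattered_exampleAlgebra, ⟨_, h3 ▸ hseq⟩, fun θ I hI => ?_⟩
  obtain rfl : θ = (3 : ℕ) := hI.height_eq hseq
  refine ⟨h3, fun α hα => ?_⟩
  -- All indices up to the height are finite, so the given sequence agrees there with the explicit
  -- one.
  obtain ⟨n, rfl⟩ := Ordinal.lt_omega0.1 (hα.trans_lt (Ordinal.natCast_lt_omega0 3))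
  rw [hI.natCast_eq hseq n hα hα]
  exact exampleSequence_ne_ccrIdeal isAtomicEssentialCharacter_scalarPart
    isIrreducibleRep_ellTwoRep not_isCompactOperator_ellTwoRep_one _
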